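/- Let $\mathrm{FI}$ be the category of finite sets and injections, and consider $\mathrm{FI}^{\mathrm{op}}$ as a site in which a sieve is covering if and only if it is non-empty. (A presheaf on $\mathrm{FI}^{\mathrm{op}}$ is thus a covariant functor of the finite set $I\in\mathrm{FI}$.) For a sheaf $\mathcal F$ on this site and a finite set $J$, let $\mathcal F_{+J}$ be the sheaf $I\mapsto\mathcal F(I\sqcup J)$; if $\mathcal F$ is a module over a sheaf of rings $\mathcal O$, then $\mathcal F_{+J}$ is an $\mathcal O_{+J}$-module, and $\mathcal O_{+J}$ is an $\mathcal O$-module through the maps $\mathcal O(I)\to\mathcal O(I\sqcup J)$ induced by the inclusions $I\hookrightarrow I\sqcup J$. For a sheaf of rings $\mathcal R$ and an integer $s\ge 0$, let $\bar h^s_{\mathcal R}$ be the $\mathcal R$-module $I\mapsto\mathcal R(I)\langle\binom{I}{s}\rangle$, the free $\mathcal R(I)$-module on the set of $s$-element subsets of $I$. An $\mathcal O$-module $V$ is finitely generated if there are finitely many sections $v_k\in V(I_k)$ that generate $V$ as a sheaf of $\mathcal O$-modules, i.e. for every finite set $J$ and every $w\in V(J)$ there is an injection $J\hookrightarrow J'$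 of finite sets such that the image of $w$ in $V(J')$ is an $\mathcal O(J')$-linear combination of images of the $v_k$ under injections $I_k\hookrightarrow J'$. **Proposition.** Let $\mathcal O$ be a sheaf of fields on $\mathrm{FI}^{\mathrm{op}}$ that is not constant (i.e. not isomorphic to a constant functor), and let $V$ be a finitely generated $\mathcal O$-module. Then there is an integer $n\ge 0$ such that for any finite set $J$ of order $\ge n$ - the $\mathcal O_{+J}$-module $V_{+J}$ is isomorphic to $\bigoplus_{s=0}^N(\bar h^s_{\mathcal O_{+J}})^{\oplus\kappa_s}$ for some integers $N,\kappa_0,\dots,\kappa_N\ge 0$; - $V$ can be embedded, as an $\mathcal O$-module, into a product of copies of $\mathcal O_{+J}$. -/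

import Mathlib

open CategoryTheory CategoryTheory.Limits Opposite

universe u

/-- The objects of the category of finite sets and injections. -/
structure FI : Type (u + 1) where
  /-- the underlying set -/
  carrier : Type u
  [finite : Finite carrier]

namespace FI

instance : CoeSort FI.{u} (Type u) := ⟨FI.carrier⟩

attribute [instance] FI.finite

/-- The category of finite sets, with the injections as morphisms. -/
instance : LargeCategory FI.{u} where
  Hom I J := I.carrier ↪ J.carrier
  id I := Function.Embedding.refl I.carrier
  comp f g := Function.Embedding.trans f g

/-- The site axioms need that a span of injections can be completed to a commutative square. -/
theorem rightOreCondition_op : GrothendieckTopology.RightOreCondition FI.{u}ᵒᵖ := by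
  classical
  intro X Y Z f g
  let a : X.unop.carrier ↪ Y.unop.carrier := f.unop
  let b : X.unop.carrier ↪ Z.unop.carrier := g.unop
  let c : Z.unop.carrier → Y.unop.carrier ⊕ Z.unop.carrier := fun z =>
    if h : ∃ x, b x = z then Sum.inl (a h.choose) else Sum.inr z
  have hc : Function.Injective c := by
    intro z z' hzz
    by_cases h : ∃ x, b x = z <;> by_cases h' : ∃ x, b x = z'
    · simp only [c, dif_pos h, dif_pos h', Sum.inl.injEq] at hzz
      rw [← h.choose_spec, ← h'.choose_spec, a.injective hzz]
    · simp [c, dif_pos h, dif_neg h'] at hzz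
    · simp [c, dif_neg h, dif_pos h'] at hzz
    · simpa [c, dif_neg h, dif_neg h'] using hzz
  let W : FI.{u} := ⟨Y.unop.carrier ⊕ Z.unop.carrier⟩
  let p : Y.unop ⟶ W := (Function.Embedding.inl : Y.unop.carrier ↪ W.carrier)
  let q : Z.unop ⟶ W := (⟨c, hc⟩ : Z.unop.carrier ↪ W.carrier)
  refine ⟨op W, p.op, q.op, Quiver.Hom.unop_inj ?_⟩
  refine Function.Embedding.ext fun x => ?_
  have h : ∃ x', b x' = b x := ⟨x, rfl⟩
  change Sum.inl (a x) = c (b x)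
  simp only [c, dif_pos h]
  rw [b.injective h.choose_spec]

/-- The topology on `FIᵒᵖ` in which exactly the non-empty sieves are covering. -/
def topology : GrothendieckTopology FI.{u}ᵒᵖ :=
  GrothendieckTopology.atomic rightOreCondition_op

/-- The endofunctor `I ↦ I ⊔ J` of the category of finite sets and injections. -/
def shift (J : FI.{u}) : FI.{u} ⥤ FI.{u} where
  obj I := ⟨I.carrier ⊕ J.carrier⟩
  map f := Function.Embedding.sumMap f (Function.Embedding.refl J.carrier)
  map_id _ := Function.Embedding.ext fun x => by cases x <;> rfl
  map_comp _ _ := Function.Embedding.ext fun x => by cases x <;> rfl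

/-- The natural injections `I → I ⊔ J`. -/
def toShift (J : FI.{u}) : 𝟭 FI.{u} ⟶ shift J where
  app I := (Function.Embedding.inl : I.carrier ↪ I.carrier ⊕ J.carrier)
  naturality _ _ _ := rfl

/-- The presheaf of sets on `FIᵒᵖ` sending `I` to the set of its subsets with `s` elements. -/
def subsets (s : ℕ) : FI.{u}ᵒᵖᵒᵖ ⥤ Type u where
  obj I := {A : Finset I.unop.unop.carrier // A.card = s}
  map f := ↾fun A =>
    ⟨A.1.map (f.unop.unop : _ ↪ _), (Finset.card_map _).trans A.2⟩
  map_id _ := ConcreteCategory.hom_ext _ _ fun A =>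
    Subtype.ext (Finset.map_refl (s := A.1))
  map_comp _ _ := ConcreteCategory.hom_ext _ _ fun A =>
    Subtype.ext (Finset.map_map _ _ A.1).symm

/-- A presheaf of rings on `FIᵒᵖ`, i.e. a covariant functor of the finite set `I`. -/
abbrev RingPresheaf := FI.{u}ᵒᵖᵒᵖ ⥤ RingCat.{u}

/-- The shift `R_{+J} : I ↦ R(I ⊔ J)` of a presheaf of rings. -/
abbrev shiftRing (J : FI.{u}) (R : RingPresheaf.{u}) : RingPresheaf.{u} :=
  (shift J).op.op ⋙ R

/-- The natural homomorphism `R → R_{+J}`, given by `R(I) → R(I ⊔ J)`. -/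
def toShiftRing (J : FI.{u}) (R : RingPresheaf.{u}) : R ⟶ shiftRing J R where
  app I := R.map ((toShift J).app I.unop.unop).op.op
  naturality _ _ f := by
    simp only [Functor.comp_map, ← R.map_comp]
    rfl

/-- The `R_{+J}`-module `M_{+J} : I ↦ M(I ⊔ J)`, for an `R`-module `M`. -/
noncomputable abbrev shiftModule (J : FI.{u}) {R : RingPresheaf.{u}}
    (M : PresheafOfModules.{u} R) : PresheafOfModules.{u} (shiftRing J R) :=
  (PresheafOfModules.pushforward (F := (shift J).op) (𝟙 (shiftRing J R))).obj M

/-- `R_{+J}` as an `R`-module, through `R → R_{+J}`. -/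
noncomputable abbrev shiftUnit (J : FI.{u}) (R : RingPresheaf.{u}) : PresheafOfModules.{u} R :=
  (PresheafOfModules.restrictScalars (toShiftRing J R)).obj
    (PresheafOfModules.unit (shiftRing J R))

/-- The `R`-module `h̄^s_R`: its sections over `I` are the finite formal `R(I)`-linear combinations
of the `s`-element subsets of `I`. -/
noncomputable abbrev hbar (s : ℕ) (R : RingPresheaf.{u}) : PresheafOfModules.{u} R :=
  PresheafOfModules.freeObj (subsets s)

/-- Finite direct sums exist in the abelian category of presheaves of modules. -/
instance hasFiniteBiproducts_presheafOfModules (R : RingPresheaf.{u}) :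
    HasFiniteBiproducts (PresheafOfModules.{u} R) :=
  Abelian.hasFiniteBiproducts

/-- A sheaf of rings on `FIᵒᵖ` is constant if it is isomorphic to some `I ↦ A`
(such a presheaf is a sheaf: all transition maps are identities). -/
def IsConstant (O : Sheaf topology.{u} RingCat.{u}) : Prop :=
  ∃ A : RingCat.{u}, Nonempty (O.obj ≅ (Functor.const _).obj A)

/-- A sheaf of rings on `FIᵒᵖ` is a sheaf of fields if all its rings of sections are fields. -/
def IsSheafOfFields (O : Sheaf topology.{u} RingCat.{u}) : Prop :=
  ∀ I : FI.{u}, IsField (O.obj.obj (op (op I)))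

/-- An `O`-module is finitely generated if there are finitely many sections `v k ∈ V(I k)` that
generate it as a sheaf of `O`-modules: every section `w ∈ V(J)` is locally, i.e. after some
injection `f : J → J'`, an `O(J')`-linear combination of the images of the sections `v k` under
injections `g : I k → J'`. -/
def IsFinitelyGenerated {O : Sheaf topology.{u} RingCat.{u}} (V : SheafOfModules.{u} O) : Prop :=
  ∃ (m : ℕ) (I : Fin m → FI.{u}) (v : ∀ k, V.val.obj (op (op (I k)))),
    ∀ (J : FI.{u}) (w : V.val.obj (op (op J))), ∃ (J' : FI.{u}) (f : J ⟶ J'),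
      (V.val.map f.op.op w : V.val.obj (op (op J'))) ∈
        Submodule.span (O.obj.obj (op (op J')))
          {x : V.val.obj (op (op J')) | ∃ (k : Fin m) (g : I k ⟶ J'), x = V.val.map g.op.op (v k)}

end FI

/-! Non-constancy yields a section `y` over one point plus some finite set `J₀` whose images `y_a`
at distinct points `a` are distinct: otherwise the gluing axiom would make every section come from
the empty set (`exists_isSeparating`). This `y` is used twice, each time through Dedekind's
independence of characters.

Generators. The permutations of an `n`-element set act on the field O(n ⊔ J) through distinct
characters, because they move the `y_a`. Hence every section of V over n ⊔ J is a combination of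
sums over all permutations, and such a sum depends only on an n-element subset. So finitely many
copies of the h̄^s map locally onto V_{+J} (`exists_locallyGenerates`).

Relations. Enlarging J by C splits h̄^s into the sum, over subsets C' of C, of h̄^(s-|C'|). Take a
relation with non-zero coefficient at a subset A of top degree and index i, and let C be the
complement of A. Transported along injections that fix C and move A anywhere, the relation expresses
the summand (i, ∅) through the others (`val_shift_mem_gen`). Only summands with C' empty keep their
degree, and one of these has been removed, so the process stops at an independent family
(`exists_independent`). Coefficients of a local expression are then unique, hence descend, and the
family is a basis over every finite set (`gen_eq_top`). Bases stay bases under further shifts, so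
every large J works.

Embedding. V injects into V_{+J}. The coefficients of ∏_{a ∈ A} (X - y_a) define distinct characters
for distinct A, and so give enough functionals V_{+J} → O_{+J} to separate sections
(`exists_functionals`). -/

namespace FI

/-! ### Elementary form of the sheaves, and combinatorics of injections -/

/-- A sheaf of fields on the category of finite sets and injections, in elementary terms. -/
structure FieldSystem where
  /-- the sections over a finite set -/
  obj : ∀ (α : Type u) [Finite α], Type u
  [field : ∀ (α : Type u) [Finite α], Field (obj α)]
  /-- the transition maps -/
  map : ∀ {α β : Type u} [Finite α] [Finite β], (α ↪ β) → obj α →+* obj β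
  map_refl : ∀ {α : Type u} [Finite α] (x : obj α), map (.refl α) x = x
  map_trans : ∀ {α β γ : Type u} [Finite α] [Finite β] [Finite γ] (f : α ↪ β) (g : β ↪ γ)
    (x : obj α), map (f.trans g) x = map g (map f x)
  -- Gluing for the cover generated by `f`. Uniqueness need not be required, since ring
  -- homomorphisms between fields are injective.
  glue : ∀ {α β : Type u} [Finite α] [Finite β] (f : α ↪ β) (x : obj β),
    (∀ (γ : Type u) [Finite γ] (g h : β ↪ γ), f.trans g = f.trans h → map g x = map h x) →
      ∃ y, map f y = x

attribute [instance] FieldSystem.field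

/-- A separated presheaf of modules over a sheaf of fields, in elementary terms. -/
structure ModuleSystem (F : FieldSystem.{u}) where
  /-- the sections over a finite set -/
  obj : ∀ (α : Type u) [Finite α], Type u
  [addCommGroup : ∀ (α : Type u) [Finite α], AddCommGroup (obj α)]
  [module : ∀ (α : Type u) [Finite α], Module (F.obj α) (obj α)]
  /-- the transition maps -/
  map : ∀ {α β : Type u} [Finite α] [Finite β], (α ↪ β) → obj α →+ obj β
  map_smul : ∀ {α β : Type u} [Finite α] [Finite β] (f : α ↪ β) (a : F.obj α) (x : obj α),
    map f (a • x) = F.map f a • map f x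
  map_refl : ∀ {α : Type u} [Finite α] (x : obj α), map (.refl α) x = x
  map_trans : ∀ {α β γ : Type u} [Finite α] [Finite β] [Finite γ] (f : α ↪ β) (g : β ↪ γ)
    (x : obj α), map (f.trans g) x = map g (map f x)
  map_injective : ∀ {α β : Type u} [Finite α] [Finite β] (f : α ↪ β), Function.Injective (map f)

attribute [instance] ModuleSystem.addCommGroup ModuleSystem.module

/-- The injection `f ⊔ id`. -/
abbrev sumId {α β : Type*} (J : Type*) (f : α ↪ β) : α ⊕ J ↪ β ⊕ J :=
  f.sumMap (.refl J)

theorem sumId_trans {α β γ : Type*} (J : Type*) (f : α ↪ β) (g : β ↪ γ) :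
    sumId J (f.trans g) = (sumId J f).trans (sumId J g) :=
  Function.Embedding.ext fun x => by cases x <;> rfl

/-- An injection `α ⊔ J → β` becomes, after an enlargement of its target, of the form `f ⊔ id`. -/
theorem exists_trans_eq_sumId {α β J : Type*} (f : α ⊕ J ↪ β) :
    ∃ e : β ↪ β ⊕ J, f.trans e = sumId J (Function.Embedding.inl.trans f) := by
  classical
  refine ⟨⟨fun x => if h : ∃ j, f (.inr j) = x then .inr h.choose else .inl x, ?_⟩, ?_⟩
  · intro x y hxy
    by_cases hx : ∃ j, f (.inr j) = x <;> by_cases hy : ∃ j, f (.inr j) = y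
    · simp only [dif_pos hx, dif_pos hy, Sum.inr.injEq] at hxy
      rw [← hx.choose_spec, ← hy.choose_spec, hxy]
    · simp [dif_pos hx, dif_neg hy] at hxy
    · simp [dif_neg hx, dif_pos hy] at hxy
    · simpa only [dif_neg hx, dif_neg hy, Sum.inl.injEq] using hxy
  · refine Function.Embedding.ext fun x => ?_
    rcases x with a | j
    · have : ¬ ∃ j, f (.inr j) = f (.inl a) := fun ⟨j, hj⟩ => by
        simp at hj
      exact dif_neg this
    · have h : ∃ j', f (.inr j') = f (.inr j) := ⟨j, rfl⟩
      have h' : h.choose = j := by simpa only [f.apply_eq_iff_eq, Sum.inr.injEq] using h.choose_spec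
      exact (dif_pos h).trans (congrArg Sum.inr h')

/-- An injection `g : α → γ` extends along `f : α → β` to an injection of `β` into `γ ⊔ β`
that is the inclusion off the range of `f`. -/
theorem exists_extend {α β γ : Type*} (f : α ↪ β) (g : α ↪ γ) :
    ∃ h : β ↪ γ ⊕ β, f.trans h = g.trans .inl ∧ ∀ b, b ∉ Set.range f → h b = .inr b := by
  classical
  refine ⟨⟨fun x => if h : ∃ a, f a = x then .inl (g h.choose) else .inr x, ?_⟩, ?_, ?_⟩
  · intro x y hxy
    by_cases hx : ∃ a, f a = x <;> by_cases hy : ∃ a, f a = y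
    · simp only [dif_pos hx, dif_pos hy, Sum.inl.injEq] at hxy
      rw [← hx.choose_spec, ← hy.choose_spec, g.injective hxy]
    · simp [dif_pos hx, dif_neg hy] at hxy
    · simp [dif_neg hx, dif_pos hy] at hxy
    · simpa [dif_neg hx, dif_neg hy] using hxy
  · refine Function.Embedding.ext fun a => ?_
    have h : ∃ a', f a' = f a := ⟨a, rfl⟩
    have h' : h.choose = a := f.injective h.choose_spec
    exact (dif_pos h).trans (congrArg (fun x => Sum.inl (g x)) h')
  · intro b hb
    exact dif_neg hb

theorem map_mem_span {F : FieldSystem.{u}} (M : ModuleSystem F) {α β : Type u} [Finite α]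
    [Finite β] (f : α ↪ β) {S : Set (M.obj α)} {T : Submodule (F.obj β) (M.obj β)}
    (h : ∀ x ∈ S, M.map f x ∈ T) {w : M.obj α} (hw : w ∈ Submodule.span (F.obj α) S) :
    M.map f w ∈ T := by
  induction hw using Submodule.span_induction with
  | mem x hx => exact h x hx
  | zero => simp
  | add x y _ _ hx hy => rw [map_add]; exact T.add_mem hx hy
  | smul a x _ hx => rw [M.map_smul]; exact T.smul_mem _ hx

theorem FieldSystem.map_equiv_symm (F : FieldSystem.{u}) {α β : Type u} [Finite α] [Finite β]
    (e : α ≃ β) (x : F.obj β) : F.map e.toEmbedding (F.map e.symm.toEmbedding x) = x := by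
  rw [← F.map_trans]
  convert F.map_refl x
  exact Function.Embedding.ext fun b => by simp

theorem ModuleSystem.map_equiv_symm {F : FieldSystem.{u}} (M : ModuleSystem F) {α β : Type u}
    [Finite α] [Finite β] (e : α ≃ β) (x : M.obj β) :
    M.map e.toEmbedding (M.map e.symm.toEmbedding x) = x := by
  rw [← M.map_trans]
  convert M.map_refl x
  exact Function.Embedding.ext fun b => by simp

/-! ### Families of sections indexed by subsets, and descent of coefficients -/

/-- A natural family of sections of `M_{+J}`, indexed by the subsets with `deg i` elements of the
finite sets, for every `i`. -/
structure OrbitFamily {F : FieldSystem.{u}} (M : ModuleSystem F) (J : Type u) [Finite J]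
    (ι : Type*) where
  /-- the number of elements of the subsets that index the sections -/
  deg : ι → ℕ
  /-- the section attached to a subset -/
  sec : ι → ∀ (α : Type u) [Finite α], Finset α → M.obj (α ⊕ J)
  map_sec : ∀ (i : ι) {α β : Type u} [Finite α] [Finite β] (f : α ↪ β) (A : Finset α),
    A.card = deg i → M.map (sumId J f) (sec i α A) = sec i β (A.map f)

/-- A section over `β ⊔ J` whose two images over the pushout of `α ⊔ J → β ⊔ J` along itself agree
comes from `α ⊔ J`. -/
theorem FieldSystem.exists_map_sumId_eq (F : FieldSystem.{u}) {J α β : Type u} [Finite J]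
    [Finite α] [Finite β] (f : α ↪ β) (h : β ↪ β ⊕ β) (hf : f.trans h = f.trans .inl)
    (hh : ∀ b, b ∉ Set.range f → h b = .inr b) (x : F.obj (β ⊕ J))
    (hx : F.map (sumId J .inl) x = F.map (sumId J h) x) :
    ∃ y : F.obj (α ⊕ J), F.map (sumId J f) y = x := by
  refine F.glue _ _ fun γ _ g g' hgg => ?_
  -- `φ k` applies `k` to the first copy of `β` and to `J`, and sends the second copy to fresh
  -- points. After `h`, only the restriction of `k` to α ⊔ J is still visible, so `g` and `g'` give
  -- the same composite.
  let φ (k : β ⊕ J ↪ γ) : (β ⊕ β) ⊕ J ↪ γ ⊕ β :=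
    ⟨Sum.elim (Sum.elim (fun b => .inl (k (.inl b))) .inr) (fun j => .inl (k (.inr j))), by
      rintro ((x | x) | x) ((y | y) | y) <;> simp⟩
  have φ₁ : ∀ k b, φ k (.inl (.inl b)) = .inl (k (.inl b)) := fun _ _ => rfl
  have φ₂ : ∀ k b, φ k (.inl (.inr b)) = .inr b := fun _ _ => rfl
  have φ₃ : ∀ k j, φ k (.inr j) = .inl (k (.inr j)) := fun _ _ => rfl
  have hφ : ∀ k, F.map (k.trans .inl) x = F.map ((sumId J h).trans (φ k)) x := by
    intro k
    rw [F.map_trans (sumId J h), ← hx, ← F.map_trans]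
    congr 2
    exact Function.Embedding.ext fun b => by rcases b with b | j <;> rfl
  have hinl : F.map (Function.Embedding.inl : γ ↪ γ ⊕ β) (F.map g x) =
      F.map (Function.Embedding.inl : γ ↪ γ ⊕ β) (F.map g' x) := by
    rw [← F.map_trans, ← F.map_trans, hφ, hφ]
    congr 2
    refine Function.Embedding.ext fun b => ?_
    rcases b with b | j
    · by_cases hb : b ∈ Set.range f
      · obtain ⟨a, rfl⟩ := hb
        have h1 : h (f a) = .inl (f a) := DFunLike.congr_fun hf a
        have h2 : g (.inl (f a)) = g' (.inl (f a)) := DFunLike.congr_fun hgg (.inl a)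
        simp [φ₁, h1, h2]
      · simp [φ₂, hh b hb]
    · have h2 : g (.inr j) = g' (.inr j) := DFunLike.congr_fun hgg (.inr j)
      simp [φ₃, h2]
  exact (F.map _).injective hinl

namespace OrbitFamily

variable {F : FieldSystem.{u}} {M : ModuleSystem F} {J : Type u} [Finite J] {ι : Type*}

/-- The pairs of an index and a subset with the right number of elements. -/
abbrev Idx (Φ : OrbitFamily M J ι) (α : Type u) : Type _ :=
  {p : ι × Finset α // p.2.card = Φ.deg p.1}

noncomputable instance (Φ : OrbitFamily M J ι) (α : Type u) [Finite α] [Finite ι] :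
    Fintype (Φ.Idx α) := Fintype.ofFinite _

/-- The functoriality of the indexing sets. -/
def Idx.map (Φ : OrbitFamily M J ι) {α β : Type u} (f : α ↪ β) (p : Φ.Idx α) : Φ.Idx β :=
  ⟨(p.1.1, p.1.2.map f), (Finset.card_map _).trans p.2⟩

theorem Idx.map_injective (Φ : OrbitFamily M J ι) {α β : Type u} (f : α ↪ β) :
    Function.Injective (Idx.map Φ f) := by
  rintro ⟨⟨i, A⟩, hA⟩ ⟨⟨j, B⟩, hB⟩ h
  have h' := congrArg Subtype.val h
  simp only [Idx.map, Prod.mk.injEq, Finset.map_inj] at h'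
  obtain ⟨rfl, rfl⟩ := h'
  rfl

/-- The sections of the family over a finite set. -/
def val (Φ : OrbitFamily M J ι) {α : Type u} [Finite α] (p : Φ.Idx α) : M.obj (α ⊕ J) :=
  Φ.sec p.1.1 α p.1.2

theorem map_val (Φ : OrbitFamily M J ι) {α β : Type u} [Finite α] [Finite β] (f : α ↪ β)
    (p : Φ.Idx α) : M.map (sumId J f) (Φ.val p) = Φ.val (Idx.map Φ f p) :=
  Φ.map_sec _ f _ p.2

/-- The submodule generated by the sections of the family over a finite set. -/
abbrev gen (Φ : OrbitFamily M J ι) (α : Type u) [Finite α] :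
    Submodule (F.obj (α ⊕ J)) (M.obj (α ⊕ J)) :=
  Submodule.span _ (Set.range (Φ.val (α := α)))

theorem map_mem_gen (Φ : OrbitFamily M J ι) {α β : Type u} [Finite α] [Finite β] (f : α ↪ β)
    {w : M.obj (α ⊕ J)} (hw : w ∈ Φ.gen α) : M.map (sumId J f) w ∈ Φ.gen β := by
  refine map_mem_span M _ ?_ hw
  rintro _ ⟨p, rfl⟩
  rw [Φ.map_val]
  exact Submodule.subset_span ⟨_, rfl⟩

/-- The family generates `M_{+J}` locally. -/
def LocallyGenerates (Φ : OrbitFamily M J ι) : Prop :=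
  ∀ (α : Type u) [Finite α] (w : M.obj (α ⊕ J)),
    ∃ (β : Type u) (_ : Finite β) (f : α ↪ β), M.map (sumId J f) w ∈ Φ.gen β

/-- All linear relations between the sections of the family involve only the indices in `R`. -/
def RelationsIn [Finite ι] (Φ : OrbitFamily M J ι) (R : Set ι) : Prop :=
  ∀ (α : Type u) [Finite α] (c : Φ.Idx α → F.obj (α ⊕ J)), ∑ p, c p • Φ.val p = 0 →
    ∀ p : Φ.Idx α, p.1.1 ∉ R → c p = 0

theorem RelationsIn.linearIndependent [Finite ι] {Φ : OrbitFamily M J ι} (h : Φ.RelationsIn ∅)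
    (α : Type u) [Finite α] : LinearIndependent (F.obj (α ⊕ J)) (Φ.val (α := α)) :=
  Fintype.linearIndependent_iff.2 fun c hc p => h α c hc p (Set.notMem_empty _)

/-- The sections of the family over any finite set form a basis. -/
def IsBasis (Φ : OrbitFamily M J ι) : Prop :=
  ∀ (α : Type u) [Finite α],
    LinearIndependent (F.obj (α ⊕ J)) (Φ.val (α := α)) ∧ Φ.gen α = ⊤

/-- If the family generates locally and is independent, then it generates. -/
theorem gen_eq_top [Finite ι] {Φ : OrbitFamily M J ι} (hΦ : Φ.LocallyGenerates)
    (hR : Φ.RelationsIn ∅) (α : Type u) [Finite α] : Φ.gen α = ⊤ := by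
  classical
  refine eq_top_iff.2 fun w _ => ?_
  obtain ⟨β, _, f, hf⟩ := hΦ α w
  obtain ⟨c, hc⟩ := (Submodule.mem_span_range_iff_exists_fun _).1 hf
  -- `h` and `E` agree on the image of `α` and are disjoint elsewhere. The image of `w` expanded
  -- along both has the same coefficients by independence: this kills the terms not coming from `α`
  -- and makes the other coefficients descend.
  obtain ⟨h, hh, hh'⟩ := exists_extend f f
  have hli := hR.linearIndependent (β ⊕ β)
  let E : β ↪ β ⊕ β := .inl
  have expand : ∀ k : β ↪ β ⊕ β, M.map (sumId J k) (M.map (sumId J f) w) =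
      Finsupp.linearCombination (F.obj ((β ⊕ β) ⊕ J)) (Φ.val (α := β ⊕ β))
        (∑ p, Finsupp.single (Idx.map Φ k p) (F.map (sumId J k) (c p))) := by
    intro k
    rw [← hc, map_sum, map_sum]
    refine Finset.sum_congr rfl fun p _ => ?_
    rw [M.map_smul, Φ.map_val, Finsupp.linearCombination_single]
  have heq := hli (((expand E).symm.trans (by
    rw [← M.map_trans, ← M.map_trans, ← sumId_trans, ← sumId_trans, hh])).trans (expand h))
  have coeff : ∀ (k : β ↪ β ⊕ β) (p : Φ.Idx β),
      (∑ p, Finsupp.single (Idx.map Φ k p) (F.map (sumId J k) (c p))) (Idx.map Φ k p) =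
        F.map (sumId J k) (c p) := by
    intro k p
    rw [Finsupp.finsetSum_apply, Finset.sum_eq_single p]
    · simp
    · intro q _ hq
      exact Finsupp.single_eq_of_ne' fun e => hq (Idx.map_injective Φ k e)
    · simp
  have hzero : ∀ p : Φ.Idx β, (¬ ∃ q, Idx.map Φ f q = p) → c p = 0 := by
    intro p hp
    refine (F.map (sumId J h)).injective ?_
    rw [map_zero, ← coeff h p, ← heq, Finsupp.finsetSum_apply]
    refine Finset.sum_eq_zero fun q _ => Finsupp.single_eq_of_ne' fun e => hp ?_
    have e' := congrArg (fun r => r.1.2) e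
    have hsub : ∀ b ∈ p.1.2, b ∈ Set.range f := by
      intro b hb
      by_contra hb'
      have : h b ∈ q.1.2.map E := by
        rw [show q.1.2.map E = p.1.2.map h from e']
        exact Finset.mem_map_of_mem _ hb
      rw [hh' b hb', Finset.mem_map] at this
      obtain ⟨x, _, hx⟩ := this
      cases hx
    have himg : (p.1.2.preimage f f.injective.injOn).map f = p.1.2 := by
      rw [Finset.map_eq_image, Finset.image_preimage, Finset.filter_true_of_mem hsub]
    exact ⟨⟨(p.1.1, p.1.2.preimage f f.injective.injOn), by
      rw [← p.2, ← congrArg Finset.card himg, Finset.card_map]⟩, by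
        refine Subtype.ext (Prod.ext rfl himg)⟩
  have hdesc : ∀ q : Φ.Idx α, ∃ y, F.map (sumId J f) y = c (Idx.map Φ f q) := by
    intro q
    refine F.exists_map_sumId_eq f h hh hh' _ ?_
    have hq : Idx.map Φ E (Idx.map Φ f q) = Idx.map Φ h (Idx.map Φ f q) := by
      refine Subtype.ext (Prod.ext rfl ?_)
      change (q.1.2.map f).map E = (q.1.2.map f).map h
      rw [Finset.map_map, Finset.map_map, hh]
    rw [← coeff h, ← coeff E, heq, hq]
  choose y hy using hdesc
  have : w = ∑ q, y q • Φ.val q := by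
    refine M.map_injective (sumId J f) ?_
    rw [← hc, map_sum]
    symm
    refine Fintype.sum_of_injective _ (Idx.map_injective Φ f) _ _ ?_ ?_
    · intro p hp
      rw [hzero p (by simpa using hp), zero_smul]
    · intro q
      rw [M.map_smul, hy, Φ.map_val]
  rw [this]
  exact Submodule.sum_mem _ fun q _ => Submodule.smul_mem _ _ (Submodule.subset_span ⟨q, rfl⟩)

/-- Reindexing of a family. -/
def comap {κ : Type*} (Φ : OrbitFamily M J ι) (g : κ → ι) : OrbitFamily M J κ where
  deg k := Φ.deg (g k)
  sec k := Φ.sec (g k)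
  map_sec k := Φ.map_sec (g k)

theorem RelationsIn.comap {κ : Type*} [Finite ι] [Finite κ] {Φ : OrbitFamily M J ι} {R : Set ι}
    (hR : Φ.RelationsIn R) (g : κ → ι) (hg : Function.Injective g) :
    (Φ.comap g).RelationsIn (g ⁻¹' R) := by
  classical
  intro α _ c hc p hp
  let G : (Φ.comap g).Idx α → Φ.Idx α := fun q => ⟨(g q.1.1, q.1.2), q.2⟩
  have hG : Function.Injective G := by
    rintro ⟨⟨i, A⟩, hA⟩ ⟨⟨j, B⟩, hB⟩ h
    have h' := congrArg Subtype.val h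
    simp only [G, Prod.mk.injEq] at h'
    obtain ⟨h₁, rfl⟩ := h'
    obtain rfl := hg h₁
    rfl
  rw [← hG.extend_apply c 0 p]
  refine hR α _ ?_ _ hp
  rw [← hc]
  symm
  refine Fintype.sum_of_injective G hG _ _ ?_ ?_
  · intro q hq
    rw [Function.extend_apply' _ _ _ (by simpa using hq), Pi.zero_apply, zero_smul]
  · intro q
    rw [hG.extend_apply]
    rfl

/-- Used to discard an index whose sections are combinations of the remaining ones. -/
theorem LocallyGenerates.comap {κ : Type*} {Φ : OrbitFamily M J ι} (hΦ : Φ.LocallyGenerates)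
    (g : κ → ι) (h : ∀ (α : Type u) [Finite α] (p : Φ.Idx α), Φ.val p ∈ (Φ.comap g).gen α) :
    (Φ.comap g).LocallyGenerates := by
  intro α _ w
  obtain ⟨β, _, f, hf⟩ := hΦ α w
  have hle : Φ.gen β ≤ (Φ.comap g).gen β := Submodule.span_le.2 <| by
    rintro _ ⟨p, rfl⟩
    exact h β p
  exact ⟨β, ‹_›, f, hle hf⟩

/-! ### Shifting a family: decomposition of the subsets of α ⊔ C -/

/-- The bijection `(α ⊔ C) ⊔ J ≃ α ⊔ J'` attached to a bijection `C ⊔ J ≃ J'`. -/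
def assoc {C J J' : Type u} (σ : C ⊕ J ≃ J') (α : Type u) : (α ⊕ C) ⊕ J ≃ α ⊕ J' :=
  (Equiv.sumAssoc α C J).trans (Equiv.sumCongr (.refl α) σ)

theorem sumId_sumId_assoc {C J J' : Type u} (σ : C ⊕ J ≃ J') {α β : Type u} (f : α ↪ β) :
    (sumId J (sumId C f)).trans (assoc σ β).toEmbedding =
      (assoc σ α).toEmbedding.trans (sumId J' f) :=
  Function.Embedding.ext fun x => by rcases x with (x | x) | x <;> rfl

theorem disjSum_map_sumId {α β C : Type*} (f : α ↪ β) (A : Finset α) (C' : Finset C) :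
    (A.disjSum C').map (sumId C f) = (A.map f).disjSum C' := by
  ext x
  rcases x with x | x <;> simp [Finset.mem_map, sumId]

/-- The family of sections of `M_{+J'}` obtained by decomposing the subsets of `α ⊔ C`, for a
bijection `C ⊔ J ≃ J'`. -/
def shift (Φ : OrbitFamily M J ι) {C J' : Type u} [Finite C] [Finite J'] (σ : C ⊕ J ≃ J') :
    OrbitFamily M J' (Σ i : ι, {C' : Finset C // C'.card ≤ Φ.deg i}) where
  -- The bound on `C'` in the index type keeps this subtraction from being truncated.
  deg q := Φ.deg q.1 - q.2.1.card
  sec q α _ A := M.map (assoc σ α).toEmbedding (Φ.sec q.1 (α ⊕ C) (A.disjSum q.2.1))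
  map_sec := by
    rintro ⟨i, C', hC'⟩ α β _ _ f A hA
    dsimp only at hA ⊢
    rw [← M.map_trans, ← sumId_sumId_assoc, M.map_trans, Φ.map_sec, disjSum_map_sumId]
    rw [Finset.card_disjSum, hA]
    omega

variable {C J' : Type u} [Finite C] [Finite J']

/-- The bijection between the indexing sets of the shifted family over `α` and of the given one
over `α ⊔ C`. -/
def shiftEquiv (Φ : OrbitFamily M J ι) (σ : C ⊕ J ≃ J') (α : Type u) :
    (Φ.shift σ).Idx α ≃ Φ.Idx (α ⊕ C) where
  toFun p := ⟨(p.1.1.1, p.1.2.disjSum p.1.1.2.1), by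
    have h₁ := p.2
    have h₂ := p.1.1.2.2
    dsimp only [shift] at h₁
    dsimp only
    rw [Finset.card_disjSum, h₁]
    omega⟩
  invFun p := ⟨(⟨p.1.1, p.1.2.toRight, by
      have h₁ := p.2
      have h₂ := Finset.card_toLeft_add_card_toRight (u := p.1.2)
      omega⟩, p.1.2.toLeft), by
    have h₁ := p.2
    have h₂ := Finset.card_toLeft_add_card_toRight (u := p.1.2)
    dsimp only [shift]
    omega⟩
  left_inv p := by
    rcases p with ⟨⟨⟨i, C', h⟩, A⟩, h'⟩
    exact Subtype.ext (Prod.ext (by simp) (by simp))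
  right_inv p := by
    exact Subtype.ext (Prod.ext rfl Finset.toLeft_disjSum_toRight)

theorem map_val_shiftEquiv (Φ : OrbitFamily M J ι) (σ : C ⊕ J ≃ J') {α : Type u} [Finite α]
    (p : (Φ.shift σ).Idx α) :
    M.map (assoc σ α).toEmbedding (Φ.val (Φ.shiftEquiv σ α p)) = (Φ.shift σ).val p := rfl

theorem map_mem_gen_shift (Φ : OrbitFamily M J ι) (σ : C ⊕ J ≃ J') {α : Type u} [Finite α]
    {w : M.obj ((α ⊕ C) ⊕ J)} (hw : w ∈ Φ.gen (α ⊕ C)) :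
    M.map (assoc σ α).toEmbedding w ∈ (Φ.shift σ).gen α := by
  refine map_mem_span M _ ?_ hw
  rintro _ ⟨p, rfl⟩
  rw [← (Φ.shiftEquiv σ α).apply_symm_apply p, map_val_shiftEquiv]
  exact Submodule.subset_span ⟨_, rfl⟩

theorem LocallyGenerates.shift {Φ : OrbitFamily M J ι} (hΦ : Φ.LocallyGenerates)
    (σ : C ⊕ J ≃ J') : (Φ.shift σ).LocallyGenerates := by
  intro α _ w
  obtain ⟨β, _, f, hf⟩ := hΦ (α ⊕ C) (M.map (assoc σ α).symm.toEmbedding w)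
  obtain ⟨e, he⟩ := exists_trans_eq_sumId f
  refine ⟨β, ‹_›, Function.Embedding.inl.trans f, ?_⟩
  have := Φ.map_mem_gen_shift σ (Φ.map_mem_gen e hf)
  rwa [← M.map_trans (sumId J f), ← sumId_trans, he, ← M.map_trans, sumId_sumId_assoc,
    M.map_trans, M.map_equiv_symm] at this

theorem RelationsIn.shift [Finite ι] {Φ : OrbitFamily M J ι} {R : Set ι} (hR : Φ.RelationsIn R)
    (σ : C ⊕ J ≃ J') : (Φ.shift σ).RelationsIn {q | q.1 ∈ R} := by
  intro α _ c hc p hp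
  refine (F.map (assoc σ α).symm.toEmbedding).injective ?_
  rw [map_zero]
  have := hR (α ⊕ C)
    (fun q => F.map (assoc σ α).symm.toEmbedding (c ((Φ.shiftEquiv σ α).symm q))) ?_
    (Φ.shiftEquiv σ α p) hp
  · simpa using this
  · refine M.map_injective (assoc σ α).toEmbedding ?_
    rw [map_zero, ← hc, map_sum]
    refine Fintype.sum_equiv (Φ.shiftEquiv σ α).symm _ _ fun q => ?_
    rw [M.map_smul, F.map_equiv_symm, ← map_val_shiftEquiv, Equiv.apply_symm_apply]

/-! ### Elimination of relations by shifting -/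

/-- A relation in which a section of index `i` occurs makes the corresponding section of the
shifted family superfluous. -/
theorem val_shift_mem_gen [Finite ι] (Φ : OrbitFamily M J ι) {α : Type u} [Finite α]
    (c : Φ.Idx α → F.obj (α ⊕ J)) (hc : ∑ p, c p • Φ.val p = 0) (p₀ : Φ.Idx α) (hp₀ : c p₀ ≠ 0)
    (q₀ : Σ i : ι, {C' : Finset {a // a ∉ p₀.1.2} // C'.card ≤ Φ.deg i})
    (hq₀ : q₀ = ⟨p₀.1.1, ∅, Nat.zero_le _⟩) (β : Type u) [Finite β]
    (p : (Φ.shift (Equiv.refl ({a // a ∉ p₀.1.2} ⊕ J))).Idx β) :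
    (Φ.shift (Equiv.refl ({a // a ∉ p₀.1.2} ⊕ J))).val p ∈
      ((Φ.shift (Equiv.refl ({a // a ∉ p₀.1.2} ⊕ J))).comap
        (Subtype.val : {q // q ≠ q₀} → _)).gen β := by
  classical
  let Ψ := Φ.shift (Equiv.refl ({a // a ∉ p₀.1.2} ⊕ J))
  change Ψ.val p ∈ (Ψ.comap (Subtype.val : {q // q ≠ q₀} → _)).gen β
  have easy : ∀ p : Ψ.Idx β, p.1.1 ≠ q₀ → Ψ.val p ∈ (Ψ.comap
      (Subtype.val : {q // q ≠ q₀} → _)).gen β := fun p hp =>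
    Submodule.subset_span ⟨⟨(⟨p.1.1, hp⟩, p.1.2), p.2⟩, rfl⟩
  by_cases hp : p.1.1 = q₀
  swap
  · exact easy p hp
  have hcard : p₀.1.2.card = p.1.2.card := by
    have h := p.2
    rw [hp, hq₀] at h
    rw [h, p₀.2]
    rfl
  let e : {a // a ∈ p₀.1.2} ≃ {b // b ∈ p.1.2} := Finset.equivOfCardEq hcard
  -- `g` moves the subset of `p₀` onto that of `p` and is the identity on its complement, the set
  -- adjoined to `J`. Transporting the relation along `g` sends `p₀` to `p`.
  let g : α ↪ β ⊕ {a // a ∉ p₀.1.2} := (Equiv.sumCompl (· ∈ p₀.1.2)).symm.toEmbedding.trans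
    (Function.Embedding.sumMap (e.toEmbedding.trans (.subtype _)) (.refl _))
  have hg₁ : ∀ a (ha : a ∈ p₀.1.2), g a = .inl (e ⟨a, ha⟩).1 := by
    intro a ha
    simp [g, Equiv.sumCompl_symm_apply_of_pos ha]
  have hg₂ : ∀ a (ha : a ∉ p₀.1.2), g a = .inr ⟨a, ha⟩ := by
    intro a ha
    simp [g, Equiv.sumCompl_symm_apply_of_neg ha]
  let τ := Equiv.refl ({a // a ∉ p₀.1.2} ⊕ J)
  let E := (assoc τ β).toEmbedding
  let θ : Φ.Idx α → Ψ.Idx β := fun r => (Φ.shiftEquiv τ β).symm (Idx.map Φ g r)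
  have hθ : ∀ r, M.map ((sumId J g).trans E) (Φ.val r) = Ψ.val (θ r) := by
    intro r
    rw [M.map_trans, Φ.map_val, ← map_val_shiftEquiv, Equiv.apply_symm_apply]
  have hθ₀ : θ p₀ = p := by
    rw [Equiv.symm_apply_eq]
    refine Subtype.ext (Prod.ext ?_ ?_)
    · change p₀.1.1 = p.1.1.1
      rw [hp, hq₀]
    · change p₀.1.2.map g = p.1.2.disjSum p.1.1.2.1
      rw [hp, hq₀]
      ext x
      rcases x with x | x
      · simp only [Finset.mem_map, Finset.inl_mem_disjSum]
        constructor
        · rintro ⟨a, ha, h⟩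
          rw [hg₁ a ha] at h
          cases h
          exact (e ⟨a, ha⟩).2
        · intro hx
          refine ⟨(e.symm ⟨x, hx⟩).1, (e.symm ⟨x, hx⟩).2, ?_⟩
          rw [hg₁ _ (e.symm ⟨x, hx⟩).2]
          simp
      · simp only [Finset.mem_map, Finset.inr_mem_disjSum, Finset.notMem_empty, iff_false]
        rintro ⟨a, ha, h⟩
        rw [hg₁ a ha] at h
        cases h
  -- Another term of index `q₀` would have a subset disjoint from the complement of that of `p₀`,
  -- hence contained in it and of equal size, hence equal to it.
  have hθ₁ : ∀ r, r ≠ p₀ → (θ r).1.1 ≠ q₀ := by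
    intro r hr h
    apply hr
    have hi : r.1.1 = p₀.1.1 := by
      have := congrArg Sigma.fst h
      rw [hq₀] at this
      exact this
    have hsub : r.1.2 ⊆ p₀.1.2 := by
      intro a ha
      by_contra ha'
      have hm : (⟨a, ha'⟩ : {a // a ∉ p₀.1.2}) ∈ (θ r).1.1.2.1 := by
        change _ ∈ (r.1.2.map g).toRight
        rw [Finset.mem_toRight, ← hg₂ a ha']
        exact Finset.mem_map_of_mem _ ha
      rw [h, hq₀] at hm
      simp at hm
    refine Subtype.ext (Prod.ext hi (Finset.eq_of_subset_of_card_le hsub ?_))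
    rw [r.2, p₀.2, hi]
  have hrel := congrArg (M.map ((sumId J g).trans E)) hc
  rw [map_zero, map_sum, ← Finset.add_sum_erase _ _ (Finset.mem_univ p₀), M.map_smul, hθ,
    hθ₀] at hrel
  have hne : F.map ((sumId J g).trans E) (c p₀) ≠ 0 := by simpa using hp₀
  rw [← Submodule.smul_mem_iff _ hne, eq_neg_of_add_eq_zero_left hrel]
  refine Submodule.neg_mem _ (Submodule.sum_mem _ fun r hr => ?_)
  rw [M.map_smul, hθ]
  exact Submodule.smul_mem _ _ (easy _ (hθ₁ r (Finset.ne_of_mem_erase hr)))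

/-- A locally generating family can be replaced, after a shift, by an independent one. -/
theorem exists_independent (d : ℕ) : ∀ {J ι : Type u} [Finite J] [Finite ι]
    (Φ : OrbitFamily M J ι) (R : Set ι), Φ.LocallyGenerates → Φ.RelationsIn R →
      (∀ i ∈ R, Φ.deg i < d) → ∃ (J' ι' : Type u) (_ : Finite J') (_ : Finite ι')
        (Ψ : OrbitFamily M J' ι'), Nonempty (J ↪ J') ∧ Ψ.LocallyGenerates ∧ Ψ.RelationsIn ∅ := by
  induction d with
  | zero =>
    intro J ι _ _ Φ R hΦ hR hd
    obtain rfl : R = ∅ := Set.eq_empty_of_forall_notMem fun i hi => Nat.not_lt_zero _ (hd i hi)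
    exact ⟨J, ι, _, _, Φ, ⟨.refl J⟩, hΦ, hR⟩
  | succ d ih =>
    -- Inner induction on the number `r` of indices in `R` of the top degree `d`. When no relation
    -- involves them any more, `R` shrinks to the lower degrees and the outer hypothesis applies.
    suffices H : ∀ (r : ℕ) {J ι : Type u} [Finite J] [Finite ι] (Φ : OrbitFamily M J ι)
        (R : Set ι), {i ∈ R | Φ.deg i = d}.ncard = r → Φ.LocallyGenerates → Φ.RelationsIn R →
        (∀ i ∈ R, Φ.deg i < d + 1) → ∃ (J' ι' : Type u) (_ : Finite J') (_ : Finite ι')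
          (Ψ : OrbitFamily M J' ι'), Nonempty (J ↪ J') ∧ Ψ.LocallyGenerates ∧
            Ψ.RelationsIn ∅ from
      fun {_ _ _ _} Φ R => H _ Φ R rfl
    intro r
    induction r using Nat.strong_induction_on with
    | _ r ihr =>
    intro J ι _ _ Φ R hr hΦ hR hd
    by_cases h : Φ.RelationsIn {i ∈ R | Φ.deg i < d}
    · exact ih Φ _ hΦ h fun i hi => hi.2
    · simp only [RelationsIn, not_forall] at h
      obtain ⟨α, _, c, hc, p₀, hp₀, hne⟩ := h
      have hmem : p₀.1.1 ∈ R := by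
        by_contra h
        exact hne (hR α c hc p₀ h)
      have hdeg : Φ.deg p₀.1.1 = d := by
        have h₁ := hd _ hmem
        have h₂ : ¬ Φ.deg p₀.1.1 < d := fun h => hp₀ ⟨hmem, h⟩
        omega
      let q₀ : Σ i : ι, {C' : Finset {a // a ∉ p₀.1.2} // C'.card ≤ Φ.deg i} :=
        ⟨p₀.1.1, ∅, Nat.zero_le _⟩
      have hgen := (hΦ.shift (Equiv.refl ({a // a ∉ p₀.1.2} ⊕ J))).comap
        (Subtype.val : {q // q ≠ q₀} → _) fun β _ p =>
          Φ.val_shift_mem_gen c hc p₀ hne q₀ rfl β p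
      have hrel := (hR.shift (Equiv.refl ({a // a ∉ p₀.1.2} ⊕ J))).comap
        (Subtype.val : {q // q ≠ q₀} → _) Subtype.val_injective
      have hlt : {q ∈ (Subtype.val : {q // q ≠ q₀} → _) ⁻¹' {q | q.1 ∈ R} |
          Φ.deg q.1.1 - q.1.2.1.card = d}.ncard < r := by
        rw [← hr]
        -- A shifted index has degree `d` only if its subset `C'` is empty, so such indices inject
        -- into the old ones of degree `d`, and the one of `p₀` is missed because `q₀` was dropped.
        have key : ∀ q : {q // q ≠ q₀}, q.1.1 ∈ R → Φ.deg q.1.1 - q.1.2.1.card = d →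
            q.1.1 ≠ p₀.1.1 ∧ q.1.2.1 = ∅ ∧ Φ.deg q.1.1 = d := by
          rintro ⟨⟨i, C', hC'⟩, hq⟩ hi hi'
          have h₁ := hd i hi
          dsimp only at hi' hi ⊢
          have h₀ : C'.card = 0 := by omega
          have hC : C' = ∅ := Finset.card_eq_zero.1 h₀
          subst hC
          refine ⟨?_, rfl, by omega⟩
          rintro rfl
          exact hq rfl
        have hlt : ({i ∈ R | Φ.deg i = d} \ {p₀.1.1}).ncard < {i ∈ R | Φ.deg i = d}.ncard :=
          Set.ncard_sdiff_singleton_lt_of_mem ⟨hmem, hdeg⟩ (Set.toFinite _)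
        refine lt_of_le_of_lt (Set.ncard_le_ncard_of_injOn (fun q => q.1.1) ?_ ?_
          (Set.toFinite _)) hlt
        · rintro q ⟨hq₁, hq₂⟩
          obtain ⟨h₁, h₂, h₃⟩ := key q hq₁ hq₂
          exact ⟨⟨hq₁, h₃⟩, h₁⟩
        · rintro q ⟨hq₁, hq₂⟩ q' ⟨hq₁', hq₂'⟩ hqq
          obtain ⟨-, h₂, -⟩ := key q hq₁ hq₂
          obtain ⟨-, h₂', -⟩ := key q' hq₁' hq₂'
          rcases q with ⟨⟨i, C', hC'⟩, hq⟩
          rcases q' with ⟨⟨i', C'', hC''⟩, hq'⟩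
          dsimp only at hqq h₂ h₂'
          subst hqq h₂ h₂'
          rfl
      obtain ⟨J', ι', h₁, h₂, Ψ, ⟨j⟩, h₃, h₄⟩ := ihr _ hlt _ _ rfl hgen hrel fun q hq => by
        have h₁ := hd _ hq
        change Φ.deg q.1.1 - q.1.2.1.card < d + 1
        omega
      exact ⟨J', ι', h₁, h₂, Ψ, ⟨Function.Embedding.inr.trans j⟩, h₃, h₄⟩

end OrbitFamily
-- Separating sections from non-constancy
/-- A section over `J` with one point added is separating if its images for distinct choices of the
added point are distinct. -/
def FieldSystem.IsSeparating (F : FieldSystem.{u}) {J : Type u} [Finite J]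
    (y : F.obj (PUnit.{u + 1} ⊕ J)) : Prop :=
  ∀ (α : Type u) [Finite α], Function.Injective fun a : α => F.map (sumId J (.punit a)) y

/-- If the images at two distinct points agree, they already agree over a two-point set plus `J`,
since transition maps are injective. Any two injections that agree on `J` and differ at the point
factor through that set, so `y` would descend to `J` by gluing. -/
theorem FieldSystem.isSeparating_of_notMem_range {F : FieldSystem.{u}} {J : Type u} [Finite J]
    {y : F.obj (PUnit.{u + 1} ⊕ J)} (hy : y ∉ Set.range (F.map (.inr : J ↪ PUnit.{u + 1} ⊕ J))) :
    F.IsSeparating y := by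
  intro α _ a b hab
  by_contra hne
  refine hy (F.glue _ _ fun γ _ g h hgh => ?_)
  have hJ : ∀ j, g (.inr j) = h (.inr j) := fun j => DFunLike.congr_fun hgh j
  by_cases h₀ : g (.inl ⟨⟩) = h (.inl ⟨⟩)
  · have : g = h := Function.Embedding.ext fun x => by
      rcases x with x | j
      · exact h₀
      · exact hJ j
    rw [this]
  let e : ULift.{u} Bool ↪ α := ⟨fun t => cond t.down a b, by
    rintro ⟨_ | _⟩ ⟨_ | _⟩ h <;> simp_all [eq_comm]⟩
  have hB : F.map (sumId J (.punit ⟨true⟩)) y =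
      F.map (sumId J (.punit (⟨false⟩ : ULift.{u} Bool))) y := by
    refine (F.map (sumId J e)).injective ?_
    rw [← F.map_trans, ← F.map_trans, ← sumId_trans, ← sumId_trans]
    exact hab
  let k : ULift.{u} Bool ⊕ J ↪ γ :=
    ⟨Sum.elim (fun t => cond t.down (g (.inl ⟨⟩)) (h (.inl ⟨⟩))) (fun j => g (.inr j)), by
      rintro (⟨_ | _⟩ | j) (⟨_ | _⟩ | j') hk <;>
        simp only [Sum.elim_inl, Sum.elim_inr, cond_true, cond_false, hJ] at hk
      · rfl
      · exact absurd hk.symm h₀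
      · simp at hk
      · exact absurd hk h₀
      · rfl
      · simp [← hJ] at hk
      · simp at hk
      · simp [← hJ] at hk
      · rw [Sum.inr.inj (h.injective hk)]⟩
  have h₁ : g = (sumId J (.punit ⟨true⟩)).trans k := Function.Embedding.ext fun x => by
    rcases x with x | x <;> rfl
  have h₂ : h = (sumId J (.punit ⟨false⟩)).trans k := Function.Embedding.ext fun x => by
    rcases x with x | x
    · rfl
    · exact (hJ x).symm
  rw [h₁, h₂, F.map_trans, F.map_trans, hB]

theorem FieldSystem.IsSeparating.map {F : FieldSystem.{u}} {J J' : Type u} [Finite J] [Finite J']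
    {y : F.obj (PUnit.{u + 1} ⊕ J)} (hy : F.IsSeparating y) (j : J ↪ J') :
    F.IsSeparating (F.map (Function.Embedding.sumMap (.refl _) j) y) := by
  intro α _ a b hab
  refine hy α ((F.map (Function.Embedding.sumMap (.refl α) j)).injective ?_)
  simp only [← F.map_trans] at hab ⊢
  have key : ∀ c : α, (sumId J (Function.Embedding.punit c)).trans
      (Function.Embedding.sumMap (.refl α) j) =
      (Function.Embedding.sumMap (.refl _) j).trans (sumId J' (Function.Embedding.punit c)) :=
    fun c => Function.Embedding.ext fun x => by rcases x with x | x <;> rfl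
  rw [key, key]
  exact hab

/-- Without a separating section, adjoining one point never creates new sections, and induction on
the size of `α` contradicts `hF`. -/
theorem FieldSystem.exists_isSeparating (F : FieldSystem.{u})
    (hF : ¬ ∀ (α : Type u) [Finite α],
      Function.Surjective (F.map (Function.Embedding.ofIsEmpty : PEmpty.{u + 1} ↪ α))) :
    ∃ (J : Type u) (_ : Finite J) (y : F.obj (PUnit.{u + 1} ⊕ J)), F.IsSeparating y := by
  by_contra hcon
  have hsurj : ∀ (J : Type u) [Finite J],
      Function.Surjective (F.map (.inr : J ↪ PUnit.{u + 1} ⊕ J)) := by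
    intro J _ y
    by_contra hy
    exact hcon ⟨J, ‹_›, y, isSeparating_of_notMem_range hy⟩
  refine hF fun α hα => ?_
  refine Finite.induction_empty_option (P := fun α => ∀ [Finite α],
    Function.Surjective (F.map (Function.Embedding.ofIsEmpty : PEmpty.{u + 1} ↪ α)))
    ?_ ?_ ?_ α
  · intro α β e hα _ x
    have := Finite.of_equiv β e.symm
    obtain ⟨z, hz⟩ := hα (F.map e.symm.toEmbedding x)
    refine ⟨z, ?_⟩
    rw [← F.map_equiv_symm e x, ← hz, ← F.map_trans]
    congr 2
    exact Subsingleton.elim _ _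
  · intro _ x
    refine ⟨x, ?_⟩
    convert F.map_refl x
    exact Subsingleton.elim _ _
  · intro α _ hα _ x
    let e : PUnit.{u + 1} ⊕ α ≃ Option α :=
      (Equiv.sumComm _ _).trans (Equiv.optionEquivSumPUnit α).symm
    obtain ⟨z, hz⟩ := hsurj α (F.map e.symm.toEmbedding x)
    obtain ⟨t, ht⟩ := hα z
    refine ⟨t, ?_⟩
    rw [← F.map_equiv_symm e x, ← hz, ← ht, ← F.map_trans, ← F.map_trans]
    congr 2
    exact Subsingleton.elim _ _

/-! ### Generation by symmetrized sections -/

/-- Dedekind's independence of characters, in dual form. -/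
theorem span_range_monoidHom_eq_top {X K E : Type*} [Monoid X] [Field K] [Finite E]
    (χ : E → X →* K) (hχ : Function.Injective χ) :
    Submodule.span K (Set.range fun (x : X) (e : E) => χ e x) = ⊤ := by
  classical
  have := Fintype.ofFinite E
  by_contra h
  obtain ⟨φ, hφ, hle⟩ := Submodule.exists_le_ker_of_lt_top _ (lt_top_iff_ne_top.2 h)
  -- The values of the functional `φ` on the standard basis would be the coefficients of a linear
  -- relation between the distinct characters `χ e`.
  have hli := (linearIndependent_monoidHom X K).comp χ hχ
  rw [Fintype.linearIndependent_iff] at hli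
  refine hφ (LinearMap.pi_ext' fun e => LinearMap.ext_ring ?_)
  refine hli (fun e => φ (Pi.single e 1)) ?_ e
  funext x
  have hx : φ (fun e => χ e x) = 0 := hle (Submodule.subset_span ⟨x, rfl⟩)
  rw [LinearMap.pi_apply_eq_sum_univ] at hx
  rw [Finset.sum_apply, Pi.zero_apply, ← hx]
  refine Finset.sum_congr rfl fun e _ => ?_
  have hs : (Pi.single e 1 : E → K) = fun j => if e = j then 1 else 0 := by
    funext j
    rw [Pi.single_apply]
    simp only [eq_comm]
  rw [hs, smul_eq_mul, mul_comm]
  rfl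

/-- An injection into `β ⊔ J` involves boundedly many elements of `β`. -/
theorem exists_eq_trans_sumId {I β J : Type u} [Finite I] (g : I ↪ β ⊕ J) :
    ∃ (s : Fin (Nat.card I + 1)) (τ : I ↪ ULift.{u} (Fin s) ⊕ J) (e : ULift.{u} (Fin s) ↪ β),
      g = τ.trans (sumId J e) := by
  let T := {b : β // ∃ x, g x = .inl b}
  choose r hr using fun t : T => t.2
  have hri : Function.Injective r := fun t t' h => by
    have := hr t
    rw [h, hr t'] at this
    exact Subtype.ext (Sum.inl.inj this).symm
  have : Finite T := Finite.of_injective r hri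
  have hcard : Nat.card T < Nat.card I + 1 :=
    Nat.lt_succ_of_le (Nat.card_le_card_of_injective r hri)
  let E : T ≃ ULift.{u} (Fin (Nat.card T)) := (Finite.equivFin T).trans Equiv.ulift.symm
  have hex : ∀ x, ∃ z : T ⊕ J, Sum.map Subtype.val id z = g x := by
    intro x
    rcases h : g x with b | j
    · exact ⟨.inl ⟨b, x, h⟩, rfl⟩
    · exact ⟨.inr j, rfl⟩
  choose z hz using hex
  have hzi : Function.Injective z := fun x x' h => g.injective (by rw [← hz, ← hz, h])
  refine ⟨⟨Nat.card T, hcard⟩, (⟨z, hzi⟩ : I ↪ T ⊕ J).trans (sumId J E.toEmbedding),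
    E.symm.toEmbedding.trans (.subtype _), Function.Embedding.ext fun x => ?_⟩
  rw [← hz x]
  change _ = sumId J (E.symm.toEmbedding.trans (.subtype _)) (sumId J E.toEmbedding (z x))
  rcases z x with t | j <;> simp [sumId]
  rfl

namespace OrbitFamily

variable {F : FieldSystem.{u}} {M : ModuleSystem F} {J : Type u} [Finite J] {ι : Type*}

open Classical in
/-- The family of the sums of the images of given sections `w k` over `{0, …, n k - 1} ⊔ J` under
all injections with a given image. -/
noncomputable def symmetrization (n : ι → ℕ) (w : ∀ k, M.obj (ULift.{u} (Fin (n k)) ⊕ J)) :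
    OrbitFamily M J ι where
  deg := n
  sec k α _ A :=
    letI := Fintype.ofFinite α
    ∑ e ∈ Finset.univ.filter fun e : ULift.{u} (Fin (n k)) ↪ α => Set.range e = (A : Set α),
      M.map (sumId J e) (w k)
  map_sec k α β _ _ f A _ := by
    let := Fintype.ofFinite α
    let := Fintype.ofFinite β
    rw [map_sum]
    refine Finset.sum_bij (fun e _ => e.trans f) ?_ ?_ ?_ ?_
    · intro e he
      simp only [Finset.mem_filter, Finset.mem_univ, true_and] at he ⊢
      rw [Finset.coe_map, ← he, ← Set.range_comp]
      rfl
    · intro e _ e' _ h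
      exact Function.Embedding.ext fun x => f.injective (DFunLike.congr_fun h x)
    · intro e he
      simp only [Finset.mem_filter, Finset.mem_univ, true_and] at he
      have hx : ∀ x, ∃ a ∈ A, f a = e x := by
        intro x
        have : e x ∈ Set.range e := ⟨x, rfl⟩
        rw [he] at this
        simpa using this
      choose a ha ha' using hx
      have hai : Function.Injective a := fun x x' h => e.injective (by rw [← ha', ← ha', h])
      refine ⟨⟨a, hai⟩, ?_, Function.Embedding.ext ha'⟩
      simp only [Finset.mem_filter, Finset.mem_univ, true_and]
      ext b
      constructor
      · rintro ⟨x, rfl⟩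
        exact ha x
      · intro hb
        have : f b ∈ Set.range e := by
          rw [he]
          simpa using hb
        obtain ⟨x, hx⟩ := this
        exact ⟨x, f.injective ((ha' x).trans hx)⟩
    · intro e _
      rw [← M.map_trans, ← sumId_trans]

/-- Every section over `{0, …, n - 1} ⊔ J` is a linear combination of symmetrized sections. -/
theorem exists_sum_smul_symmetrization_eq {y : F.obj (PUnit.{u + 1} ⊕ J)} (hy : F.IsSeparating y)
    (n : ℕ) (x : M.obj (ULift.{u} (Fin n) ⊕ J)) :
    ∃ (m : ℕ) (b c : Fin m → F.obj (ULift.{u} (Fin n) ⊕ J)),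
      ∑ i, c i • (symmetrization (fun _ => n) fun i => b i • x).sec i (ULift.{u} (Fin n))
        Finset.univ = x := by
  classical
  let χ (e : ULift.{u} (Fin n) ↪ ULift.{u} (Fin n)) :
      F.obj (ULift.{u} (Fin n) ⊕ J) →* F.obj (ULift.{u} (Fin n) ⊕ J) := F.map (sumId J e)
  have hχ : Function.Injective χ := by
    intro e e' h
    refine Function.Embedding.ext fun t => hy _ ?_
    have := DFunLike.congr_fun h (F.map (sumId J (.punit t)) y)
    change F.map _ (F.map _ _) = F.map _ (F.map _ _) at this
    rw [← F.map_trans, ← F.map_trans, ← sumId_trans, ← sumId_trans] at this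
    exact this
  -- Solves ∑ cᵢ χₑ(bᵢ) = 1 for `e` the identity and 0 otherwise. With these coefficients, all terms
  -- of the symmetrizations of the bᵢ x cancel except `x`.
  have hmem : (Pi.single (.refl _) 1 :
      (ULift.{u} (Fin n) ↪ ULift.{u} (Fin n)) → F.obj (ULift.{u} (Fin n) ⊕ J)) ∈ Submodule.span
      (F.obj (ULift.{u} (Fin n) ⊕ J)) (Set.range fun b e => χ e b) := by
    rw [span_range_monoidHom_eq_top χ hχ]
    trivial
  obtain ⟨m, c, b, hbc⟩ := Submodule.mem_span_set'.1 hmem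
  choose b' hb' using fun i => (b i).2
  refine ⟨m, b', c, ?_⟩
  have hall : ∀ i, (symmetrization (fun _ => n) fun i => b' i • x).sec i (ULift.{u} (Fin n))
      Finset.univ = ∑ e : ULift.{u} (Fin n) ↪ ULift.{u} (Fin n),
        χ e (b' i) • M.map (sumId J e) x := by
    intro i
    dsimp only [symmetrization]
    refine Finset.sum_congr (Finset.ext fun e => ?_) fun e _ => M.map_smul _ _ _
    have := (Finite.injective_iff_surjective.1 e.injective).range_eq
    simp [this]
  simp only [hall, Finset.smul_sum, smul_smul]
  rw [Finset.sum_comm]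
  simp only [← Finset.sum_smul]
  have hcoef : ∀ e, ∑ i, c i * χ e (b' i) = Pi.single (M := fun _ => F.obj _) (.refl _) 1 e := by
    intro e
    rw [← hbc, Finset.sum_apply]
    refine Finset.sum_congr rfl fun i _ => ?_
    rw [Pi.smul_apply, ← hb' i]
    rfl
  simp only [hcoef]
  rw [Finset.sum_eq_single (.refl _)]
  · rw [Pi.single_eq_same, one_smul]
    convert M.map_refl x
    exact Function.Embedding.ext fun x => by rcases x with x | x <;> rfl
  · intro e _ he
    rw [Pi.single_eq_of_ne he, zero_smul]
  · simp

end OrbitFamily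

/-- Finite generation, in elementary terms. -/
def ModuleSystem.FinitelyGenerated {F : FieldSystem.{u}} (M : ModuleSystem F) : Prop :=
  ∃ (m : ℕ) (I : Fin m → Type u) (_ : ∀ k, Finite (I k)) (v : ∀ k, M.obj (I k)),
    ∀ (α : Type u) [Finite α] (w : M.obj α), ∃ (β : Type u) (_ : Finite β) (f : α ↪ β),
      M.map f w ∈ Submodule.span (F.obj β) {x | ∃ (k : Fin m) (g : I k ↪ β), x = M.map g (v k)}

namespace OrbitFamily

variable {F : FieldSystem.{u}} {M : ModuleSystem F} {J : Type u} [Finite J]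

/-- An injection of `I k` into β ⊔ J meets `β` in at most |I k| points, so it factors through one of
finitely many maps to s ⊔ J. Each resulting section over s ⊔ J is a combination of finitely many
symmetrized ones. -/
theorem exists_locallyGenerates (hM : M.FinitelyGenerated) {y : F.obj (PUnit.{u + 1} ⊕ J)}
    (hy : F.IsSeparating y) : ∃ (ι : Type u) (_ : Finite ι) (Φ : OrbitFamily M J ι),
      Φ.LocallyGenerates := by
  obtain ⟨m, I, _, v, hv⟩ := hM
  let P := Σ k : Fin m, Σ s : Fin (Nat.card (I k) + 1), I k ↪ ULift.{u} (Fin s) ⊕ J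
  choose l b c hbc using fun p : P =>
    exists_sum_smul_symmetrization_eq hy p.2.1 (M.map p.2.2 (v p.1))
  let Φ : OrbitFamily M J (Σ p : P, Fin (l p)) :=
    symmetrization (fun q => q.1.2.1) fun q => b q.1 q.2 • M.map q.1.2.2 (v q.1.1)
  refine ⟨_, inferInstance, Φ, ?_⟩
  intro α _ w
  obtain ⟨β, _, f, hf⟩ := hv _ w
  obtain ⟨e, he⟩ := exists_trans_eq_sumId f
  refine ⟨β, ‹_›, Function.Embedding.inl.trans f, ?_⟩
  rw [← he, M.map_trans]
  refine map_mem_span M e ?_ hf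
  rintro _ ⟨k, g, rfl⟩
  rw [← M.map_trans]
  obtain ⟨s, τ, e', h⟩ := exists_eq_trans_sumId (g.trans e)
  rw [h, M.map_trans]
  refine Φ.map_mem_gen e' ?_
  rw [← hbc ⟨k, s, τ⟩]
  refine Submodule.sum_mem _ fun i _ => Submodule.smul_mem _ _ (Submodule.subset_span ?_)
  have hcard : (Finset.univ : Finset (ULift.{u} (Fin s))).card = s := by simp
  exact ⟨⟨(⟨⟨k, s, τ⟩, i⟩, Finset.univ), hcard⟩, rfl⟩

/-- The structure theorem for finitely generated modules, in terms of families of sections. -/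
theorem exists_basis (hM : M.FinitelyGenerated) (hF : ¬ ∀ (α : Type u) [Finite α],
    Function.Surjective (F.map (Function.Embedding.ofIsEmpty : PEmpty.{u + 1} ↪ α))) :
    ∃ n : ℕ, ∀ (J : Type u) [Finite J], n ≤ Nat.card J →
      (∃ y : F.obj (PUnit.{u + 1} ⊕ J), F.IsSeparating y) ∧
      ∃ (ι : Type u) (_ : Finite ι) (Φ : OrbitFamily M J ι), Φ.IsBasis := by
  classical
  obtain ⟨J₀, _, y, hy⟩ := F.exists_isSeparating hF
  obtain ⟨ι₀, _, Φ₀, hΦ₀⟩ := exists_locallyGenerates hM hy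
  let := Fintype.ofFinite ι₀
  obtain ⟨J₁, ι₁, _, _, Φ, ⟨j⟩, hΦ, hR⟩ := exists_independent
    (Finset.univ.sup Φ₀.deg + 1) Φ₀ Set.univ hΦ₀ (fun _ _ _ _ p hp => absurd trivial hp)
    fun i _ => Nat.lt_succ_of_le (Finset.le_sup (Finset.mem_univ i))
  refine ⟨Nat.card J₁, fun J _ hJ => ?_⟩
  obtain ⟨k⟩ : Nonempty (J₁ ↪ J) := by
    let := Fintype.ofFinite J₁
    let := Fintype.ofFinite J
    rw [Nat.card_eq_fintype_card, Nat.card_eq_fintype_card] at hJ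
    exact Function.Embedding.nonempty_of_card_le hJ
  -- Any `J` with at least |J₁| elements is `J₁` enlarged by a complement, and shifting by it
  -- preserves independence and local generation.
  let σ : {x // x ∉ Set.range k} ⊕ J₁ ≃ J := (Equiv.sumComm _ _).trans
    ((Equiv.sumCongr (Equiv.ofInjective k k.injective) (.refl _)).trans
      (Equiv.sumCompl (· ∈ Set.range k)))
  refine ⟨⟨_, hy.map (j.trans k)⟩, _, inferInstance, Φ.shift σ, fun α _ => ?_⟩
  have h₁ : (Φ.shift σ).RelationsIn ∅ := hR.shift σ
  exact ⟨h₁.linearIndependent α, gen_eq_top (hΦ.shift σ) h₁ α⟩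

end OrbitFamily

/-! ### Characters attached to subsets, and functionals -/

section Weight

variable {F : FieldSystem.{u}} {J : Type u} [Finite J]

open Polynomial in
/-- The polynomials in the elementary symmetric functions of the images of `y` at the elements of a
subset `A`. -/
noncomputable def weight (y : F.obj (PUnit.{u + 1} ⊕ J)) {α : Type u} [Finite α] (A : Finset α) :
    MvPolynomial ℕ ℤ →+* F.obj (α ⊕ J) :=
  MvPolynomial.eval₂Hom (Int.castRingHom _) fun r =>
    (∏ a ∈ A, (X - C (F.map (sumId J (.punit a)) y))).coeff r

theorem map_weight (y : F.obj (PUnit.{u + 1} ⊕ J)) {α β : Type u} [Finite α] [Finite β]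
    (f : α ↪ β) (A : Finset α) (t : MvPolynomial ℕ ℤ) :
    F.map (sumId J f) (weight y A t) = weight y (A.map f) t := by
  rw [← RingHom.comp_apply]
  congr 1
  refine MvPolynomial.ringHom_ext' (RingHom.ext_int _ _) fun r => ?_
  simp only [weight, RingHom.comp_apply, MvPolynomial.coe_eval₂Hom, MvPolynomial.eval₂_X]
  rw [← Polynomial.coeff_map, Polynomial.map_prod, Finset.prod_map]
  congr 1
  refine Finset.prod_congr rfl fun a _ => ?_
  rw [Polynomial.map_sub, Polynomial.map_X, Polynomial.map_C, ← F.map_trans, ← sumId_trans]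
  rfl

/-- The character at `A` determines ∏_{a ∈ A} (X - y_a), hence its roots, hence `A`, because the y_a
are distinct. -/
theorem weight_injective {y : F.obj (PUnit.{u + 1} ⊕ J)} (hy : F.IsSeparating y) (α : Type u)
    [Finite α] : Function.Injective fun A : Finset α =>
      (weight y A : MvPolynomial ℕ ℤ →* F.obj (α ⊕ J)) := by
  classical
  intro A B h
  have hp : ∏ a ∈ A, (Polynomial.X - Polynomial.C (F.map (sumId J (.punit a)) y)) =
      ∏ a ∈ B, (Polynomial.X - Polynomial.C (F.map (sumId J (.punit a)) y)) := by
    ext r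
    simpa [weight] using DFunLike.congr_fun h (MvPolynomial.X r)
  have hroots : ∀ A : Finset α,
      (∏ a ∈ A, (Polynomial.X - Polynomial.C (F.map (sumId J (.punit a)) y))).roots =
        A.val.map fun a => F.map (sumId J (.punit a)) y := by
    intro A
    rw [← Polynomial.roots_multiset_prod_X_sub_C (A.val.map fun a => F.map (sumId J (.punit a)) y),
      Multiset.map_map]
    rfl
  have hr := congrArg Polynomial.roots hp
  rw [hroots, hroots] at hr
  exact Finset.val_injective (Multiset.map_injective (hy α) hr)

end Weight

namespace OrbitFamily

variable {F : FieldSystem.{u}} {M : ModuleSystem F} {J : Type u} [Finite J] {ι : Type*}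

/-- The basis formed by the sections of the family. -/
noncomputable def IsBasis.basis {Φ : OrbitFamily M J ι} (h : Φ.IsBasis) (α : Type u) [Finite α] :
    Module.Basis (Φ.Idx α) (F.obj (α ⊕ J)) (M.obj (α ⊕ J)) :=
  Module.Basis.mk (h α).1 (h α).2.ge

theorem IsBasis.basis_apply {Φ : OrbitFamily M J ι} (h : Φ.IsBasis) {α : Type u} [Finite α]
    (p : Φ.Idx α) : h.basis α p = Φ.val p := Module.Basis.mk_apply _ _ _

/-- The functional at (i, t) sends the basis section of index `i` at `A` to the weight of `A` at
`t`, and those of other indices to 0. If all of them kill `w`, then for each `i` the coordinates of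
`w` form a linear relation between distinct characters of the multiplicative monoid of ℤ[X₀, X₁, …],
so they vanish. -/
theorem IsBasis.exists_functionals [Finite ι] {Φ : OrbitFamily M J ι} (h : Φ.IsBasis)
    {y : F.obj (PUnit.{u + 1} ⊕ J)} (hy : F.IsSeparating y) :
    ∃ (T : Type u)
      (L : T → ∀ (α : Type u) [Finite α], M.obj (α ⊕ J) →ₗ[F.obj (α ⊕ J)] F.obj (α ⊕ J)),
      (∀ (t : T) {α β : Type u} [Finite α] [Finite β] (f : α ↪ β) (w : M.obj (α ⊕ J)),
        L t β (M.map (sumId J f) w) = F.map (sumId J f) (L t α w)) ∧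
      ∀ {α : Type u} [Finite α] (w : M.obj (α ⊕ J)), (∀ t, L t α w = 0) → w = 0 := by
  classical
  -- `ι` may live in any universe; replacing it by `Fin n` puts the index set of the functionals in
  -- `Type u`.
  obtain ⟨n, ⟨ε⟩⟩ := Finite.exists_equiv_fin ι
  let L (t : ULift.{u} (Fin n × MvPolynomial ℕ ℤ)) (α : Type u) [Finite α] :
      M.obj (α ⊕ J) →ₗ[F.obj (α ⊕ J)] F.obj (α ⊕ J) :=
    (h.basis α).constr ℕ fun p => if ε p.1.1 = t.down.1 then weight y p.1.2 t.down.2 else 0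
  have hL : ∀ t {α : Type u} [Finite α] (p : Φ.Idx α),
      L t α (Φ.val p) = if ε p.1.1 = t.down.1 then weight y p.1.2 t.down.2 else 0 := by
    intro t α _ p
    rw [← h.basis_apply, Module.Basis.constr_basis]
  refine ⟨_, L, ?_, ?_⟩
  · intro t α β _ _ f w
    have hw : w ∈ Φ.gen α := by
      rw [(h α).2]
      trivial
    induction hw using Submodule.span_induction with
    | mem x hx =>
      obtain ⟨p, rfl⟩ := hx
      rw [Φ.map_val, hL, hL]
      by_cases hp : ε p.1.1 = t.down.1
      · rw [if_pos hp, if_pos (show ε (Idx.map Φ f p).1.1 = _ from hp), map_weight]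
        rfl
      · rw [if_neg hp, if_neg (show ¬ ε (Idx.map Φ f p).1.1 = _ from hp), map_zero]
    | zero => simp
    | add x x' _ _ hx hx' => simp only [map_add, hx, hx']
    | smul a x _ hx => rw [M.map_smul, map_smul, hx, map_smul, smul_eq_mul, smul_eq_mul, map_mul]
  · intro α _ w hw
    rw [← (h.basis α).sum_repr w]
    refine Finset.sum_eq_zero fun p hp => ?_
    suffices hz : (h.basis α).repr w p = 0 by rw [hz, zero_smul]
    have hli := (linearIndependent_monoidHom (MvPolynomial ℕ ℤ) (F.obj (α ⊕ J))).comp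
      (fun q : {q : Φ.Idx α // q.1.1 = p.1.1} =>
        (weight y q.1.1.2 : MvPolynomial ℕ ℤ →* F.obj (α ⊕ J))) (by
        rintro ⟨⟨⟨i, A⟩, hA⟩, hi⟩ ⟨⟨⟨i', A'⟩, hA'⟩, hi'⟩ hq
        have := weight_injective hy α hq
        dsimp only at hi hi' this
        subst hi hi' this
        rfl)
    rw [Fintype.linearIndependent_iff] at hli
    refine hli (fun q => (h.basis α).repr w q.1) ?_ ⟨p, rfl⟩
    funext t
    have h₀ := hw ⟨(ε p.1.1, t)⟩
    rw [← (h.basis α).sum_repr w, map_sum] at h₀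
    simp only [map_smul, h.basis_apply, hL, EmbeddingLike.apply_eq_iff_eq, smul_ite, smul_zero]
      at h₀
    rw [← Finset.sum_filter, Finset.sum_subtype _ (p := fun q : Φ.Idx α => q.1.1 = p.1.1)
      (by simp)] at h₀
    rw [Finset.sum_apply, Pi.zero_apply, ← h₀]
    rfl

/-- Groups the indices by degree: `N` is the maximal degree and `κ s` the number of indices of
degree `s`. -/
theorem IsBasis.exists_sigma [Finite ι] {Φ : OrbitFamily M J ι} (h : Φ.IsBasis) :
    ∃ (N : ℕ) (κ : Fin (N + 1) → ℕ) (Ψ : OrbitFamily M J (Σ s : Fin (N + 1), Fin (κ s))),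
      (∀ q, Ψ.deg q = q.1) ∧ Ψ.IsBasis := by
  classical
  have := Fintype.ofFinite ι
  let N := Finset.univ.sup Φ.deg
  let d (i : ι) : Fin (N + 1) :=
    ⟨Φ.deg i, Nat.lt_succ_of_le (Finset.le_sup (f := Φ.deg) (Finset.mem_univ i))⟩
  let e : ι ≃ Σ s : Fin (N + 1), Fin (Nat.card {i // d i = s}) :=
    (Equiv.sigmaFiberEquiv d).symm.trans (Equiv.sigmaCongrRight fun s => Finite.equivFin _)
  refine ⟨N, fun s => Nat.card {i // d i = s}, Φ.comap e.symm, ?_, ?_⟩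
  · rintro ⟨s, k⟩
    have : d (e.symm ⟨s, k⟩) = s := ((Finite.equivFin {i // d i = s}).symm k).2
    exact congrArg Fin.val this
  · intro α _
    let E : (Φ.comap e.symm).Idx α → Φ.Idx α := fun p => ⟨(e.symm p.1.1, p.1.2), p.2⟩
    have hE : Function.Injective E := by
      rintro ⟨⟨i, A⟩, hA⟩ ⟨⟨j, B⟩, hB⟩ hij
      have h' := congrArg Subtype.val hij
      simp only [E, Prod.mk.injEq, EmbeddingLike.apply_eq_iff_eq] at h'
      obtain ⟨rfl, rfl⟩ := h'
      rfl
    refine ⟨(h α).1.comp E hE, ?_⟩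
    rw [← (h α).2]
    refine congrArg (Submodule.span _) (Set.Subset.antisymm ?_ ?_)
    · rintro _ ⟨p, rfl⟩
      exact ⟨E p, rfl⟩
    · rintro _ ⟨⟨⟨i, A⟩, hA⟩, rfl⟩
      have hA' : A.card = (Φ.comap e.symm).deg (e i) := by simpa [comap] using hA
      refine ⟨⟨(e i, A), hA'⟩, ?_⟩
      change Φ.sec (e.symm (e i)) α A = Φ.sec i α A
      rw [e.symm_apply_apply]

end OrbitFamily
-- From sheaves on the site to the elementary form
/-- An injection, as a morphism of `FIᵒᵖᵒᵖ`. -/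
def opHom {α β : Type u} [Finite α] [Finite β] (f : α ↪ β) :
    op (op (FI.mk α)) ⟶ op (op (FI.mk β)) :=
  Quiver.Hom.op (Quiver.Hom.op (show FI.mk α ⟶ FI.mk β from f))

theorem generate_singleton_mem_topology {X Y : FI.{u}ᵒᵖ} (f : X ⟶ Y) :
    Sieve.generate (Presieve.singleton f) ∈ topology.{u} Y :=
  ⟨X, f, X, 𝟙 X, f, Presieve.singleton_self f, Category.id_comp f⟩

/-- The sheaf condition is tested on homomorphisms out of a ring. The polynomial ring in one
variable over ℤ represents the underlying set, so testing on it gives gluing of elements for the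
cover generated by `f`. -/
theorem exists_map_eq_of_isSheaf {P : RingPresheaf.{u}} (hP : Presheaf.IsSheaf topology.{u} P)
    {X Y : FI.{u}ᵒᵖ} (f : X ⟶ Y) (x : P.obj (op X))
    (hx : ∀ (Z : FI.{u}ᵒᵖ) (g h : Z ⟶ X), g ≫ f = h ≫ f → P.map g.op x = P.map h.op x) :
    ∃ y : P.obj (op Y), P.map f.op y = x := by
  let E := RingCat.of (Polynomial (ULift.{u} ℤ))
  have hs := hP E _ (generate_singleton_mem_topology f)
  rw [← Presieve.isSheafFor_iff_generate] at hs
  let ev {S : RingCat.{u}} (s : S) : E ⟶ S := RingCat.ofHom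
    (Polynomial.eval₂RingHom' ((Int.castRingHom S).comp ULift.ringEquiv.toRingHom) s
      fun a => Int.cast_commute _ _)
  have hev : ∀ {S : RingCat.{u}} (s : S), ev s (Polynomial.X : Polynomial (ULift.{u} ℤ)) = s :=
    fun s => Polynomial.eval₂_X _ _
  have hext : ∀ {S : RingCat.{u}} (a b : E ⟶ S), a (Polynomial.X : Polynomial (ULift.{u} ℤ)) =
      b (Polynomial.X : Polynomial (ULift.{u} ℤ)) → a = b := by
    intro S a b h
    refine RingCat.hom_ext (Polynomial.ringHom_ext' ?_ h)
    have : a.hom.comp (Polynomial.C.comp ULift.ringEquiv.symm.toRingHom) =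
        b.hom.comp (Polynomial.C.comp ULift.ringEquiv.symm.toRingHom) := RingHom.ext_int _ _
    ext ⟨n⟩
    exact DFunLike.congr_fun this n
  obtain ⟨t, ht, -⟩ := Presieve.isSheafFor_singleton.1 hs (ev x) fun {Z} g h hgh => by
    refine hext _ _ ?_
    change P.map g.op (ev x _) = P.map h.op (ev x _)
    rw [hev]
    exact hx Z g h hgh
  refine ⟨(show E ⟶ P.obj (op Y) from t) (Polynomial.X : Polynomial (ULift.{u} ℤ)), ?_⟩
  have := congrArg (fun a : E ⟶ P.obj (op X) => a (Polynomial.X : Polynomial (ULift.{u} ℤ))) ht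
  dsimp only at this
  rw [hev] at this
  exact this

/-- Same device, with ℤ representing the underlying set of an abelian group; only separatedness is
needed. -/
theorem map_injective_of_isSheaf {P : FI.{u}ᵒᵖᵒᵖ ⥤ AddCommGrpCat.{u}}
    (hP : Presheaf.IsSheaf topology.{u} P) {X Y : FI.{u}ᵒᵖ} (f : X ⟶ Y) :
    Function.Injective (P.map f.op) := by
  have hs := (hP (AddCommGrpCat.of (ULift.{u} ℤ)) _
    (generate_singleton_mem_topology f))
  rw [← Presieve.isSheafFor_iff_generate] at hs
  have hinj := Presieve.isSeparatedFor_singleton.1 hs.isSeparatedFor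
  intro a b hab
  let ev {S : AddCommGrpCat.{u}} (s : S) : AddCommGrpCat.of (ULift.{u} ℤ) ⟶ S :=
    AddCommGrpCat.ofHom ((zmultiplesHom S s).comp AddEquiv.ulift.toAddMonoidHom)
  have hev : ∀ {S : AddCommGrpCat.{u}} (s : S), ev s (ULift.up (1 : ℤ)) = s :=
    fun s => one_zsmul s
  have key : ev a = ev b := by
    refine hinj ?_
    change ev a ≫ P.map f.op = ev b ≫ P.map f.op
    ext ⟨n⟩
    change P.map f.op (n • a) = P.map f.op (n • b)
    rw [map_zsmul, map_zsmul, hab]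
  rw [← hev a, key, hev]

/-- A sheaf of fields, in elementary terms. -/
noncomputable def toFieldSystem (O : Sheaf topology.{u} RingCat.{u}) (hO : IsSheafOfFields O) :
    FieldSystem.{u} where
  obj α _ := O.obj.obj (op (op (FI.mk α)))
  field α _ := (hO (FI.mk α)).toField
  map f := (O.obj.map (opHom f)).hom
  map_refl {α _} x := by
    change O.obj.map (𝟙 _) x = x
    simp
  map_trans f g x := by
    change O.obj.map (opHom f ≫ opHom g) x = _
    rw [O.obj.map_comp]
    rfl
  glue {α β _ _} f x hx :=
    exists_map_eq_of_isSheaf O.property (X := op (FI.mk β)) (Y := op (FI.mk α))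
      (Quiver.Hom.op (show FI.mk α ⟶ FI.mk β from f)) x fun Z g h hgh =>
        @hx Z.unop.carrier _ g.unop h.unop (congrArg Quiver.Hom.unop hgh)

/-- A sheaf of modules, in elementary terms. -/
noncomputable def toModuleSystem {O : Sheaf topology.{u} RingCat.{u}} (hO : IsSheafOfFields O)
    (V : SheafOfModules.{u} O) : ModuleSystem (toFieldSystem O hO) where
  obj α _ := V.val.obj (op (op (FI.mk α)))
  addCommGroup α _ := inferInstanceAs (AddCommGroup (V.val.obj (op (op (FI.mk α)))))
  module α _ := (V.val.obj (op (op (FI.mk α)))).isModule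
  map f := AddMonoidHom.mk' (V.val.map (opHom f)) fun x y => map_add (V.val.map (opHom f)).hom x y
  map_smul f a x := V.val.map_smul (opHom f) a x
  map_refl {α _} x := by
    change V.val.map (𝟙 _) x = x
    simp
    rfl
  map_trans f g x := V.val.map_comp_apply (opHom f) (opHom g) x
  map_injective {α β _ _} f := map_injective_of_isSheaf V.isSheaf (X := op (FI.mk β))
    (Y := op (FI.mk α)) (Quiver.Hom.op (show FI.mk α ⟶ FI.mk β from f))

theorem finitelyGenerated_toModuleSystem {O : Sheaf topology.{u} RingCat.{u}}
    (hO : IsSheafOfFields O) {V : SheafOfModules.{u} O} (hV : IsFinitelyGenerated V) :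
    (toModuleSystem hO V).FinitelyGenerated := by
  obtain ⟨m, I, v, hv⟩ := hV
  refine ⟨m, fun k => (I k).carrier, fun k => (I k).finite, v, fun α _ w => ?_⟩
  obtain ⟨J', f, hf⟩ := hv (FI.mk α) w
  exact ⟨J'.carrier, J'.finite, f, hf⟩

/-- The maps from the value at the empty set are injective as maps of fields, hence bijective, and
they are natural because the empty set is initial. -/
theorem isConstant_of_surjective {O : Sheaf topology.{u} RingCat.{u}} (hO : IsSheafOfFields O)
    (h : ∀ (α : Type u) [Finite α], Function.Surjective ((toFieldSystem O hO).map
      (Function.Embedding.ofIsEmpty : PEmpty.{u + 1} ↪ α))) : IsConstant O := by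
  let F := toFieldSystem O hO
  let φ (X : FI.{u}ᵒᵖᵒᵖ) : O.obj.obj (op (op (FI.mk PEmpty.{u + 1}))) ⟶ O.obj.obj X :=
    O.obj.map (opHom (β := X.unop.unop.carrier) Function.Embedding.ofIsEmpty)
  have hφ : ∀ X, IsIso (φ X) := by
    intro X
    have hb : Function.Bijective (φ X) :=
      ⟨(F.map (Function.Embedding.ofIsEmpty : PEmpty.{u + 1} ↪ X.unop.unop.carrier)).injective,
        h X.unop.unop.carrier⟩
    exact (ConcreteCategory.isIso_iff_bijective (φ X)).2 hb
  refine ⟨O.obj.obj (op (op (FI.mk PEmpty.{u + 1}))),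
    ⟨(NatIso.ofComponents (fun X => @asIso _ _ _ _ (φ X) (hφ X)) ?_).symm⟩⟩
  intro X Y f
  dsimp only [asIso_hom, Functor.const_obj_map]
  refine (Category.id_comp _).trans ?_
  change O.obj.map _ = O.obj.map _ ≫ O.obj.map f
  rw [← O.obj.map_comp]
  refine congrArg O.obj.map (Quiver.Hom.unop_inj (Quiver.Hom.unop_inj ?_))
  exact Function.Embedding.ext fun x => x.elim

/-! ### From bases and functionals to morphisms of modules -/

namespace OrbitFamily

variable {F : FieldSystem.{u}} {M : ModuleSystem F} {J : Type u} [Finite J]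

theorem IsBasis.eq_zero {Q : Type*} [Fintype Q] {Φ : OrbitFamily M J Q} (h : Φ.IsBasis)
    {n : Q → ℕ} (hn : ∀ q, Φ.deg q = n q) (α : Type u) [Finite α]
    (c : ∀ q, {A : Finset α // A.card = n q} →₀ F.obj (α ⊕ J))
    (hc : ∑ q, (c q).sum (fun A a => a • Φ.sec q α A.1) = 0) (q : Q) : c q = 0 := by
  classical
  have := Fintype.ofFinite α
  let G : (Σ q, {A : Finset α // A.card = n q}) → Φ.Idx α :=
    fun r => ⟨(r.1, r.2.1), r.2.2.trans (hn r.1).symm⟩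
  have hG : Function.Injective G := by
    rintro ⟨q, A, hA⟩ ⟨q', A', hA'⟩ h
    have h' := congrArg Subtype.val h
    simp only [G, Prod.mk.injEq] at h'
    obtain ⟨rfl, rfl⟩ := h'
    rfl
  have hli := Fintype.linearIndependent_iff.1 ((h α).1.comp G hG) (fun r => c r.1 r.2) (by
    rw [← hc, Fintype.sum_sigma]
    refine Finset.sum_congr rfl fun q _ => ?_
    exact (Finsupp.sum_fintype (c q)
      (fun (A : {A : Finset α // A.card = n q}) a => a • Φ.sec q α A.1) fun A => zero_smul (F.obj (α ⊕ J)) _).symm)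
  exact Finsupp.ext fun A => hli ⟨q, A⟩

theorem IsBasis.exists_eq_sum {Q : Type*} [Fintype Q] {Φ : OrbitFamily M J Q} (h : Φ.IsBasis)
    {n : Q → ℕ} (hn : ∀ q, Φ.deg q = n q) (α : Type u) [Finite α] (w : M.obj (α ⊕ J)) :
    ∃ c : ∀ q, {A : Finset α // A.card = n q} →₀ F.obj (α ⊕ J),
      ∑ q, (c q).sum (fun A a => a • Φ.sec q α A.1) = w := by
  classical
  have hw : w ∈ Φ.gen α := by
    rw [(h α).2]
    trivial
  induction hw using Submodule.span_induction with
  | mem x hx =>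
    obtain ⟨⟨⟨q, A⟩, hA⟩, rfl⟩ := hx
    refine ⟨Pi.single q (Finsupp.single ⟨A, hA.trans (hn q)⟩ 1), ?_⟩
    rw [Finset.sum_eq_single q]
    · rw [Pi.single_eq_same]
      refine (Finsupp.sum_single_index
        (h := fun (A : {A : Finset α // A.card = n q}) a => a • Φ.sec q α A.1)
        (zero_smul _ _)).trans ?_
      exact one_smul _ _
    · intro q' _ hq'
      rw [Pi.single_eq_of_ne hq', Finsupp.sum_zero_index]
    · simp
  | zero => exact ⟨0, by simp⟩
  | add x y _ _ hx hy =>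
    obtain ⟨c, hc⟩ := hx
    obtain ⟨d, hd⟩ := hy
    refine ⟨c + d, ?_⟩
    rw [← hc, ← hd, ← Finset.sum_add_distrib]
    refine Finset.sum_congr rfl fun q _ => ?_
    exact Finsupp.sum_add_index' (fun _ => zero_smul _ _) fun _ _ _ => add_smul _ _ _
  | smul a x _ hx =>
    obtain ⟨c, hc⟩ := hx
    refine ⟨fun q => a • c q, ?_⟩
    rw [← hc, Finset.smul_sum]
    refine Finset.sum_congr rfl fun q _ => ?_
    rw [Finsupp.smul_sum]
    refine (Finsupp.sum_smul_index'
        (h := fun (A : {A : Finset α // A.card = n q}) a => a • Φ.sec q α A.1)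
        fun _ => zero_smul _ _).trans ?_
    simp only [smul_eq_mul, mul_smul]

end OrbitFamily

section Interface

variable {O : Sheaf topology.{u} RingCat.{u}} {hO : IsSheafOfFields O} {V : SheafOfModules.{u} O}
  {J : FI.{u}}

/-- The morphism `h̄^s → V_{+J}` attached to a natural family of sections of `V_{+J}`. -/
noncomputable def OrbitFamily.hom {Q : Type} (Φ : OrbitFamily (toModuleSystem hO V) J.carrier Q)
    (q : Q) (s : ℕ) (hs : Φ.deg q = s) :
    hbar s (shiftRing J O.obj) ⟶ shiftModule J V.val :=
  PresheafOfModules.freeObjDesc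
    { app X := ↾fun A => Φ.sec q X.unop.unop.carrier A.1
      naturality X Y f := ConcreteCategory.hom_ext _ _ fun A =>
        (Φ.map_sec q (α := X.unop.unop.carrier) (β := Y.unop.unop.carrier) f.unop.unop A.1
          (A.2.trans hs.symm)).symm }

theorem PresheafOfModules.eq_sum_biproduct {R : RingPresheaf.{u}} {Q : Type} [Fintype Q]
    (f : Q → PresheafOfModules.{u} R) (X : FI.{u}ᵒᵖᵒᵖ) (x : (⨁ f).obj X) :
    x = ∑ q, (biproduct.ι f q).app X ((biproduct.π f q).app X x) := by
  let E : ((⨁ f) ⟶ ⨁ f) →+ (⨁ f).obj X :=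
    AddMonoidHom.mk' (fun g => g.app X x) fun _ _ => rfl
  have h := congrArg E (biproduct.total (f := f))
  rw [map_sum] at h
  exact h.symm

/-- The morphism from the direct sum defined by the family is bijective on sections over every
finite set, which is exactly the basis property. -/
theorem OrbitFamily.IsBasis.nonempty_iso {Q : Type} [Fintype Q]
    {Φ : OrbitFamily (toModuleSystem hO V) J.carrier Q} (h : Φ.IsBasis) {n : Q → ℕ}
    (hn : ∀ q, Φ.deg q = n q) :
    Nonempty (shiftModule J V.val ≅ ⨁ fun q => hbar (n q) (shiftRing J O.obj)) := by
  classical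
  let f (q : Q) := hbar (n q) (shiftRing J O.obj)
  let D : (⨁ f) ⟶ shiftModule J V.val := biproduct.desc fun q => Φ.hom q (n q) (hn q)
  have hι : ∀ (X : FI.{u}ᵒᵖᵒᵖ) (q : Q) (c : (f q).obj X),
      D.app X ((biproduct.ι f q).app X c) = (Φ.hom q (n q) (hn q)).app X c := by
    intro X q c
    rw [← biproduct.ι_desc (fun q => Φ.hom q (n q) (hn q)) q]
    rfl
  have hbij : ∀ X, Function.Bijective (D.app X) := by
    intro X
    constructor
    · refine (injective_iff_map_eq_zero (D.app X).hom).2 fun x hx => ?_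
      rw [PresheafOfModules.eq_sum_biproduct f X x] at hx ⊢
      have hx' : ∑ q, (Φ.hom q (n q) (hn q)).app X ((biproduct.π f q).app X x) = 0 := by
        rw [← hx, map_sum]
        exact Finset.sum_congr rfl fun q _ => (hι X q _).symm
      refine Finset.sum_eq_zero fun q _ => ?_
      have : (biproduct.π f q).app X x = 0 :=
        h.eq_zero hn X.unop.unop.carrier (fun q => (biproduct.π f q).app X x) hx' q
      rw [this, map_zero]
    · intro w
      obtain ⟨c, hc⟩ := h.exists_eq_sum hn X.unop.unop.carrier w
      refine ⟨∑ q, (biproduct.ι f q).app X (c q), ?_⟩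
      rw [← hc]
      refine (map_sum (D.app X).hom _ _).trans ?_
      exact Finset.sum_congr rfl fun q _ => hι X q (c q)
  have hiso : ∀ X, IsIso (D.app X) := fun X => (ConcreteCategory.isIso_iff_bijective _).2 (hbij X)
  exact ⟨(PresheafOfModules.isoMk (fun X => asIso (D.app X)) fun X Y g => D.naturality g).symm⟩

/-- The morphism `V → O_{+J}` attached to a natural family of functionals on `V_{+J}`. -/
noncomputable def functionalHom
    (L : ∀ (α : Type u) [Finite α], (toModuleSystem hO V).obj (α ⊕ J.carrier)
      →ₗ[(toFieldSystem O hO).obj (α ⊕ J.carrier)] (toFieldSystem O hO).obj (α ⊕ J.carrier))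
    (hL : ∀ {α β : Type u} [Finite α] [Finite β] (f : α ↪ β)
      (w : (toModuleSystem hO V).obj (α ⊕ J.carrier)),
      L β ((toModuleSystem hO V).map (sumId J.carrier f) w) =
        (toFieldSystem O hO).map (sumId J.carrier f) (L α w)) :
    V.val ⟶ shiftUnit J O.obj where
  app X := ModuleCat.ofHom (Y := (shiftUnit J O.obj).obj X)
    { toFun w := L X.unop.unop.carrier ((toModuleSystem hO V).map .inl w)
      map_add' w w' := (congrArg (L X.unop.unop.carrier)
        (map_add ((toModuleSystem hO V).map .inl) w w')).trans
          (map_add (L X.unop.unop.carrier) _ _)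
      map_smul' a w := by
        refine (congrArg (L X.unop.unop.carrier)
          ((toModuleSystem hO V).map_smul .inl a w)).trans ?_
        exact map_smul (L X.unop.unop.carrier) _ _ }
  naturality {X Y} f := by
    refine ModuleCat.hom_ext (LinearMap.ext fun w => ?_)
    let φ : X.unop.unop.carrier ↪ Y.unop.unop.carrier := f.unop.unop
    have key : ∀ w : (toModuleSystem hO V).obj X.unop.unop.carrier,
        L Y.unop.unop.carrier ((toModuleSystem hO V).map .inl ((toModuleSystem hO V).map φ w)) =
          (toFieldSystem O hO).map (sumId J.carrier φ)
            (L X.unop.unop.carrier ((toModuleSystem hO V).map .inl w)) := by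
      intro w
      rw [← hL, ← (toModuleSystem hO V).map_trans, ← (toModuleSystem hO V).map_trans]
      rfl
    exact key w

end Interface

end FI

theorem mainTheorem6 (O : Sheaf FI.topology.{u} RingCat.{u}) (hO : FI.IsSheafOfFields O)
    (hO' : ¬ FI.IsConstant O) (V : SheafOfModules.{u} O) (hV : FI.IsFinitelyGenerated V) :
    ∃ n : ℕ, ∀ J : FI.{u}, n ≤ Nat.card J.carrier →
      (∃ (N : ℕ) (κ : Fin (N + 1) → ℕ),
        Nonempty (FI.shiftModule J V.val ≅
          ⨁ fun s : Fin (N + 1) => ⨁ fun _ : Fin (κ s) => FI.hbar s (FI.shiftRing J O.obj))) ∧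
      ∃ (ι : Type u) (f : V.val ⟶ ∏ᶜ fun _ : ι => FI.shiftUnit J O.obj), Mono f := by
  obtain ⟨n, hn⟩ := FI.OrbitFamily.exists_basis (FI.finitelyGenerated_toModuleSystem hO hV)
    fun h => hO' (FI.isConstant_of_surjective hO h)
  refine ⟨n, fun J hJ => ?_⟩
  obtain ⟨⟨y, hy⟩, ι, _, Φ, hΦ⟩ := hn J.carrier hJ
  constructor
  · obtain ⟨N, κ, Ψ, hdeg, hΨ⟩ := hΦ.exists_sigma
    obtain ⟨e⟩ := hΨ.nonempty_iso hdeg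
    exact ⟨N, κ, ⟨e ≪≫ (biproductBiproductIso (fun s : Fin (N + 1) => Fin (κ s))
      fun s _ => FI.hbar s (FI.shiftRing J O.obj)).symm⟩⟩
  · obtain ⟨T, L, hL, hL'⟩ := hΦ.exists_functionals hy
    refine ⟨T, Pi.lift fun t => FI.functionalHom (L t) (hL t), ⟨fun {Z} a b hab => ?_⟩⟩
    refine PresheafOfModules.hom_ext fun X => ModuleCat.hom_ext (LinearMap.ext fun z => ?_)
    -- Sections of `V` can be compared in V_{+J}, by separatedness, and there the functionals detect
    -- equality.
    refine (FI.toModuleSystem hO V).map_injective (α := X.unop.unop.carrier)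
      (.inl : X.unop.unop.carrier ↪ X.unop.unop.carrier ⊕ J.carrier) ?_
    rw [← sub_eq_zero]
    refine hL' _ fun t => ?_
    rw [map_sub, sub_eq_zero]
    have h := congrArg (fun m => m ≫ Pi.π _ t) hab
    simp only [Category.assoc, Pi.lift_π] at h
    exact congrArg (fun m => (PresheafOfModules.Hom.app m X).hom z) h
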